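/- Let $d,m\in\mathbb N$, $\mu\in\mathbb R$, $\alpha_j,\beta_j\in\mathbb C^d$ and $\gamma_j\in\mathbb C$ for $1\le j\le m$. On distributions on $\mathbb R^d$ consider the expressions $$H=-\tfrac12\Delta+\tfrac12|x|^2-i\mu\,(x\cdot\nabla+\nabla\cdot x),\qquad L_j=\alpha_j\cdot x+\beta_j\cdot\nabla+\gamma_j,\qquad L_j^*=\bar\alpha_j\cdot x-\bar\beta_j\cdot\nabla+\bar\gamma_j ,$$ where $a\cdot x=\sum_k a_kx_k$, $b\cdot\nabla=\sum_k b_k\partial_k$ and $(\nabla\cdot x)f=\sum_k\partial_k(x_kf)$. Let $Y$ be the operator in $L^2(\mathbb R^d)=L^2(\mathbb R^d;\mathbb C)$ given by $$Y=-iH-\tfrac12\sum_{j=1}^m L_j^*L_j,\qquad \mathcal D(Y)=\{f\in L^2(\mathbb R^d):\ \Delta f\in L^2(\mathbb R^d),\ |x|^2f\in L^2(\mathbb R^d)\}.$$ Then $Y$ is well defined, that is, $Yf\in L^2(\mathbb R^d)$ for all $f\in\mathcal D(Y)$, it is closable, and: (a) The closure $\overline Y$ is the infinitesimal generator of a $C_0$-semigroup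 of contractions on $L^2(\mathbb R^d)$. (b) For every $f\in\mathcal D(\overline Y)$ and every $j$, the distributions $L_jf$ and $L_j^*f$ belong to $L^2(\mathbb R^d)$, and $$\langle\overline Yf,g\rangle+\langle f,\overline Yg\rangle+\sum_{j=1}^m\langle L_jf,L_jg\rangle=0\qquad\text{for all } f,g\in\mathcal D(\overline Y),$$ where $\langle\cdot,\cdot\rangle$ is the standard scalar product of $L^2(\mathbb R^d)$. -/

import Mathlib

open MeasureTheory Filter Topology
open scoped NNReal SchwartzMap Laplacian LineDeriv

noncomputable section

/-! ### Strongly continuous contraction semigroups and their generators -/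

/-- A `C₀`-semigroup of contractions `(T t)_{t ≥ 0}` on the complex Banach space `E`. -/
structure C0ContractionSemigroup (E : Type*) [NormedAddCommGroup E] [NormedSpace ℂ E] where
  /-- the operator at time `t` -/
  toFun : ℝ≥0 → E →L[ℂ] E
  map_zero' : toFun 0 = ContinuousLinearMap.id ℂ E
  map_add' : ∀ s t : ℝ≥0, toFun (s + t) = toFun s ∘L toFun t
  tendsto_zero' : ∀ f : E, Tendsto (fun t => toFun t f) (𝓝 0) (𝓝 f)
  norm_le_one' : ∀ t : ℝ≥0, ‖toFun t‖ ≤ 1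

/-- `A` is the infinitesimal generator of `T`: a vector `f` lies in the domain of `A` and `A f = g`
if and only if `(T h f - f) / h → g` as `h ↓ 0`. -/
def C0ContractionSemigroup.IsGenerator {E : Type*} [NormedAddCommGroup E] [NormedSpace ℂ E]
    (T : C0ContractionSemigroup E) (A : E →ₗ.[ℂ] E) : Prop :=
  ∀ f g : E, (f, g) ∈ A.graph ↔
    Tendsto (fun h : ℝ≥0 => ((h : ℝ) : ℂ)⁻¹ • (T.toFun h f - f)) (𝓝[>] 0) (𝓝 g)

namespace QuasiFree

/-- The configuration space `ℝ^d`. -/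
abbrev Space (d : ℕ) : Type := EuclideanSpace ℝ (Fin d)

/-- The Hilbert space `L²(ℝ^d)` of complex-valued functions. -/
abbrev L2 (d : ℕ) : Type := Lp ℂ 2 (volume : Measure (Space d))

/-- Tempered distributions on `ℝ^d`. -/
abbrev Distr (d : ℕ) : Type := 𝓢'(Space d, ℂ)

/-! ### `L²`-realizations of operators on distributions -/

/-- The set of pairs `(f, g)` in `L² × L²` with `P f = g` in the sense of distributions. -/
def l2Graph {d : ℕ} (P : Distr d →L[ℂ] Distr d) : Submodule ℂ (L2 d × L2 d) where
  carrier := {p | P (Lp.toTemperedDistribution p.1) = Lp.toTemperedDistribution p.2}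
  add_mem' {p q} hp hq := by
    have hp' : P (Lp.toTemperedDistributionCLM ℂ volume 2 p.1) =
      Lp.toTemperedDistributionCLM ℂ volume 2 p.2 := hp
    have hq' : P (Lp.toTemperedDistributionCLM ℂ volume 2 q.1) =
      Lp.toTemperedDistributionCLM ℂ volume 2 q.2 := hq
    change P (Lp.toTemperedDistributionCLM ℂ volume 2 (p.1 + q.1)) =
      Lp.toTemperedDistributionCLM ℂ volume 2 (p.2 + q.2)
    rw [map_add, map_add, map_add, hp', hq']
  zero_mem' := by
    change P (Lp.toTemperedDistributionCLM ℂ volume 2 0) =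
      Lp.toTemperedDistributionCLM ℂ volume 2 0
    rw [map_zero, map_zero]
  smul_mem' c p hp := by
    have hp' : P (Lp.toTemperedDistributionCLM ℂ volume 2 p.1) =
      Lp.toTemperedDistributionCLM ℂ volume 2 p.2 := hp
    change P (Lp.toTemperedDistributionCLM ℂ volume 2 (c • p.1)) =
      Lp.toTemperedDistributionCLM ℂ volume 2 (c • p.2)
    rw [map_smul, map_smul, map_smul, hp']

/-- The maximal realization of `P` in `L²(ℝ^d)`: its domain is
`{f ∈ L² : the distribution P f belongs to L²}`, and it maps `f` to `P f`. -/
def l2Realization {d : ℕ} (P : Distr d →L[ℂ] Distr d) : L2 d →ₗ.[ℂ] L2 d :=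
  (l2Graph P).toLinearPMap

theorem l2Realization_graph {d : ℕ} (P : Distr d →L[ℂ] Distr d) :
    (l2Realization P).graph = l2Graph P := by
  refine Submodule.toLinearPMap_graph_eq _ ?_
  rintro ⟨f, g⟩ h (hf : f = 0)
  have h' : P (Lp.toTemperedDistributionCLM ℂ volume 2 f) =
    Lp.toTemperedDistributionCLM ℂ volume 2 g := h
  rw [hf, map_zero, map_zero] at h'
  exact LinearMap.ker_eq_bot'.1 (Lp.ker_toTemperedDistributionCLM_eq_bot (F := ℂ)
    (μ := (volume : Measure (Space d))) (p := 2)) g h'.symm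

theorem mem_l2Realization_domain_iff {d : ℕ} (P : Distr d →L[ℂ] Distr d) (f : L2 d) :
    f ∈ (l2Realization P).domain ↔
      ∃ g : L2 d, P (Lp.toTemperedDistribution f) = Lp.toTemperedDistribution g := by
  rw [LinearPMap.mem_domain_iff, l2Realization_graph]
  rfl

theorem l2Realization_apply {d : ℕ} (P : Distr d →L[ℂ] Distr d) (f : (l2Realization P).domain) :
    Lp.toTemperedDistribution (l2Realization P f) = P (Lp.toTemperedDistribution (f : L2 d)) := by
  have h : ((f : L2 d), l2Realization P f) ∈ l2Graph P := by
    rw [← l2Realization_graph]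
    exact (l2Realization P).mem_graph f
  exact h.symm

/-! ### The differential expressions -/

/-- Multiplication by the coordinate function `x_k`. -/
def coordMul {d : ℕ} (k : Fin d) : Distr d →L[ℂ] Distr d :=
  TemperedDistribution.smulLeftCLM ℂ (fun x : Space d => ((x k : ℝ) : ℂ))

/-- Multiplication by `|x|²`. -/
def normSqMul (d : ℕ) : Distr d →L[ℂ] Distr d :=
  TemperedDistribution.smulLeftCLM ℂ (fun x : Space d => ((‖x‖ ^ 2 : ℝ) : ℂ))

/-- `TemperedDistribution.smulLeftCLM` is the product for multipliers of temperate growth only;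
the two multipliers above are of this kind. -/
theorem coord_hasTemperateGrowth {d : ℕ} (k : Fin d) :
    (fun x : Space d => ((x k : ℝ) : ℂ)).HasTemperateGrowth :=
  (Complex.ofRealCLM ∘L (EuclideanSpace.proj k : Space d →L[ℝ] ℝ)).hasTemperateGrowth

theorem normSq_hasTemperateGrowth (d : ℕ) :
    (fun x : Space d => ((‖x‖ ^ 2 : ℝ) : ℂ)).HasTemperateGrowth :=
  Function.HasTemperateGrowth.comp Function.Complex.hasTemperateGrowth_ofReal
    (Function.hasTemperateGrowth_norm_sq (H := Space d))

/-- The distributional partial derivative `∂_k`. -/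
def partialD {d : ℕ} (k : Fin d) : Distr d →L[ℂ] Distr d :=
  LineDeriv.lineDerivOpCLM ℂ (Distr d) (EuclideanSpace.single k (1 : ℝ) : Space d)

/-- The distributional Laplacian `Δ`. -/
def laplace (d : ℕ) : Distr d →L[ℂ] Distr d :=
  LineDeriv.laplacianCLM ℂ (Space d) (Distr d)

/-- The anti-commutator `[x, ∇]₊ = x · ∇ + ∇ · x = ∑ₖ (xₖ ∂ₖ + ∂ₖ xₖ)`. -/
def antiCommXGrad (d : ℕ) : Distr d →L[ℂ] Distr d :=
  ∑ k : Fin d, (coordMul k ∘L partialD k + partialD k ∘L coordMul k)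

/-- The adjusted Hamiltonian `H = -Δ/2 + |x|²/2 - i μ [x, ∇]₊`. -/
def hamiltonian (d : ℕ) (μ : ℝ) : Distr d →L[ℂ] Distr d :=
  -((1 / 2 : ℂ) • laplace d) + (1 / 2 : ℂ) • normSqMul d
    - (Complex.I * (μ : ℂ)) • antiCommXGrad d

/-- The first order operator `α · x + β · ∇ + γ` (with `α · x = ∑ₖ αₖ xₖ`, no conjugation). -/
def lindblad {d : ℕ} (α β : Fin d → ℂ) (γ : ℂ) : Distr d →L[ℂ] Distr d :=
  ∑ k : Fin d, α k • coordMul k + ∑ k : Fin d, β k • partialD k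
    + γ • ContinuousLinearMap.id ℂ (Distr d)

/-- The formal adjoint `ᾱ · x - β̄ · ∇ + γ̄` of `α · x + β · ∇ + γ`. -/
def lindbladAdj {d : ℕ} (α β : Fin d → ℂ) (γ : ℂ) : Distr d →L[ℂ] Distr d :=
  ∑ k : Fin d, (starRingEnd ℂ (α k)) • coordMul k
    - ∑ k : Fin d, (starRingEnd ℂ (β k)) • partialD k
    + (starRingEnd ℂ γ) • ContinuousLinearMap.id ℂ (Distr d)

/-- The expression `-i H - ½ ∑ⱼ Lⱼ* Lⱼ` on distributions. -/
def yExpr {d m : ℕ} (μ : ℝ) (α β : Fin m → Fin d → ℂ) (γ : Fin m → ℂ) :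
    Distr d →L[ℂ] Distr d :=
  -(Complex.I • hamiltonian d μ)
    - (1 / 2 : ℂ) • ∑ j : Fin m, lindbladAdj (α j) (β j) (γ j) ∘L lindblad (α j) (β j) (γ j)

/-- The domain `{f ∈ L²(ℝ^d) : Δ f ∈ L²(ℝ^d), |x|² f ∈ L²(ℝ^d)}`. -/
def yDomain (d : ℕ) : Submodule ℂ (L2 d) :=
  (l2Realization (laplace d)).domain ⊓ (l2Realization (normSqMul d)).domain

/-- The operator `Y = -i H - ½ ∑ⱼ Lⱼ* Lⱼ` in `L²(ℝ^d)`, restricted to those `f` in `yDomain d` for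
which `Y f ∈ L²` (all of them do, which is part of what is claimed about `Y`). -/
def opY {d m : ℕ} (μ : ℝ) (α β : Fin m → Fin d → ℂ) (γ : Fin m → ℂ) : L2 d →ₗ.[ℂ] L2 d :=
  (l2Realization (yExpr μ α β γ)).domRestrict (yDomain d)

/-- The Lindblad operator `Lⱼ = α · x + β · ∇ + γ` in `L²(ℝ^d)`, on its maximal domain. -/
def opL {d : ℕ} (α β : Fin d → ℂ) (γ : ℂ) : L2 d →ₗ.[ℂ] L2 d :=
  l2Realization (lindblad α β γ)

/-- The operator `Lⱼ* = ᾱ · x - β̄ · ∇ + γ̄` in `L²(ℝ^d)`, on its maximal domain. -/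
def opLAdj {d : ℕ} (α β : Fin d → ℂ) (γ : ℂ) : L2 d →ₗ.[ℂ] L2 d :=
  l2Realization (lindbladAdj α β γ)

end QuasiFree

end

noncomputable section

/-! ### Contractive exponentials of bounded operators -/

section ContractionExp

variable {E : Type*} [NormedAddCommGroup E] [NormedSpace ℂ E]

/-! On Schwartz functions integration by parts gives the identity of (b) directly
(`inner_schY_add`): `H` is symmetric, so `Y` plus its formal adjoint is `-∑ Lⱼ* Lⱼ`. In particular
`2 Re ⟨f, Y f⟩ = -∑ ‖Lⱼ f‖²`, so `Y` is dissipative, and the Lumer-Phillips theorem (proved here by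
Yosida approximation, `IsDissipative.exists_isGenerator`) reduces (a) to the density of the range of
`l - Y` for `l > 0`.

Everything is measured against the number operator `N = ∑ (xₖ - ∂ₖ)(xₖ + ∂ₖ)`, which differs from
`|x|² - Δ` by the constant `d`. Products of two first order operators are bounded relative to `N`
(`comp_mem_numBounded`), raise the degree in the Hermite filtration by at most two, and `N` has norm
at most `2n` on degree `n` (`norm_schNum_le`).

Density is a Carleman argument (`eq_zero_of_forall_inner_secondOrder`). Let `g` be orthogonal to the
range and let `pₙ` be its projection onto degree at most `2n`. Only the layers next to level `n + 1`
contribute to the pairing, so dissipativity yields `l ‖pₙ₊₁‖² ≤ K (n + 1) (‖pₙ₊₂‖² - ‖pₙ‖²)`. The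
differences on the right are summable and the harmonic series is not, so the increasing sequence
`‖pₙ‖²` vanishes (`nonpos_of_carleman`). Completeness of the Hermite functions then gives `g = 0`.

The full domain is reached from Schwartz functions because `|x|² - Δ` commutes with the Hermite
projections: the projections of `f` converge to `f` together with their images under every second
order expression (`exists_approx_of_mem_yDomain`). Hence `Y` is well defined and its closure is the
closure of its restriction to Schwartz functions (`mem_closure_graph_iff`). Finally `Lⱼ` is
controlled by `Y` through the dissipation identity (`norm_schL_le`), and `Lⱼ*` by `Lⱼ` because their
commutator is a scalar (`exists_norm_schLAdj_le`), so (b) passes to the limit. -/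

theorem hasDerivAt_exp_smul_apply [CompleteSpace E] (B : E →L[ℂ] E) (f : E) (t : ℝ) :
    HasDerivAt (fun s : ℝ => NormedSpace.exp (s • B) f) (NormedSpace.exp (t • B) (B f)) t := by
  have h := hasDerivAt_exp_smul_const (𝕂 := ℝ) B t
  exact ((ContinuousLinearMap.apply ℂ E f).restrictScalars ℝ).hasFDerivAt.comp_hasDerivAt t h

/-- The one-parameter group of `B` is contractive for positive times. -/
def ContractiveExp (B : E →L[ℂ] E) : Prop :=
  ∀ t : ℝ, 0 ≤ t → ‖NormedSpace.exp (t • B)‖ ≤ 1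

theorem ContractiveExp.norm_apply_le {B : E →L[ℂ] E} (hB : ContractiveExp B) {t : ℝ} (ht : 0 ≤ t)
    (f : E) : ‖NormedSpace.exp (t • B) f‖ ≤ ‖f‖ :=
  (ContinuousLinearMap.le_of_opNorm_le _ (hB t ht) f).trans_eq (one_mul _)

/-- The path `s ↦ exp (tC) exp (s(B - C)) f` joins `exp (tC) f` to `exp (tB) f`. By commutativity
its velocity is `exp (sB) exp ((t - s)C) (B - C) f`, a product of two contractions applied to a
fixed vector. -/
theorem ContractiveExp.norm_exp_sub_exp_le [CompleteSpace E] {B C : E →L[ℂ] E}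
    (hB : ContractiveExp B)
    (hC : ContractiveExp C) (hBC : Commute B C) {t : ℝ} (ht : 0 ≤ t) (f : E) :
    ‖NormedSpace.exp (t • B) f - NormedSpace.exp (t • C) f‖ ≤ ‖B f - C f‖ * t := by
  have hc : Commute (B - C) C := hBC.sub_left (Commute.refl C)
  have key : ∀ s : ℝ, NormedSpace.exp (t • C) * NormedSpace.exp (s • (B - C))
      = NormedSpace.exp (s • B) * NormedSpace.exp ((t - s) • C) := by
    intro s
    let +nondep : NormedAlgebra ℚ (E →L[ℂ] E) := .restrictScalars ℚ ℝ _
    rw [← NormedSpace.exp_add_of_commute, ← NormedSpace.exp_add_of_commute]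
    · congr 1; module
    · exact (hBC.smul_left _).smul_right _
    · exact (hc.symm.smul_left _).smul_right _
  have hd : ∀ s ∈ Set.Icc (0 : ℝ) t, HasDerivWithinAt
      (fun s : ℝ => NormedSpace.exp (t • C) (NormedSpace.exp (s • (B - C)) f))
      (NormedSpace.exp (t • C) (NormedSpace.exp (s • (B - C)) ((B - C) f))) (Set.Icc 0 t) s := by
    intro s _
    exact (((NormedSpace.exp (t • C)).restrictScalars ℝ).hasFDerivAt.comp_hasDerivAt s
      (hasDerivAt_exp_smul_apply (B - C) f s)).hasDerivWithinAt
  have hb : ∀ s ∈ Set.Ico (0 : ℝ) t,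
      ‖NormedSpace.exp (t • C) (NormedSpace.exp (s • (B - C)) ((B - C) f))‖ ≤ ‖B f - C f‖ := by
    intro s hs
    have := DFunLike.congr_fun (key s) ((B - C) f)
    simp only [mul_apply_eq_comp] at this
    rw [this]
    exact (hB.norm_apply_le hs.1 _).trans (hC.norm_apply_le (by linarith [hs.2]) _)
  have := norm_image_sub_le_of_norm_deriv_le_segment' hd hb t (Set.right_mem_Icc.2 ht)
  have e1 := DFunLike.congr_fun (key t) f
  simp only [mul_apply_eq_comp, sub_self, zero_smul, NormedSpace.exp_zero,
    one_apply_eq_self] at e1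
  simpa [e1] using this

theorem contractiveExp_zero : ContractiveExp (0 : E →L[ℂ] E) := by
  intro t _
  rw [smul_zero, NormedSpace.exp_zero]
  exact ContinuousLinearMap.norm_id_le

theorem ContractiveExp.norm_exp_sub_self_le [CompleteSpace E] {B : E →L[ℂ] E}
    (hB : ContractiveExp B) {t : ℝ}
    (ht : 0 ≤ t) (f : E) : ‖NormedSpace.exp (t • B) f - f‖ ≤ ‖B f‖ * t := by
  simpa using hB.norm_exp_sub_exp_le contractiveExp_zero (Commute.zero_right B) ht f

/-- First order Taylor remainder. The usual bound involves `B² f`, which is not uniform along Yosida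
approximations; replacing `B f` by a nearby vector `g` leaves only `B g`, which stays bounded when
`g` lies in the domain of the limit. -/
theorem ContractiveExp.norm_exp_sub_sub_le [CompleteSpace E] {B : E →L[ℂ] E}
    (hB : ContractiveExp B) {t : ℝ}
    (ht : 0 ≤ t) (f g : E) :
    ‖NormedSpace.exp (t • B) f - f - t • B f‖ ≤ (2 * ‖B f - g‖ + ‖B g‖ * t) * t := by
  have hd : ∀ s ∈ Set.Icc (0 : ℝ) t, HasDerivWithinAt
      (fun s : ℝ => NormedSpace.exp (s • B) f - s • B f)
      (NormedSpace.exp (s • B) (B f) - (1 : ℝ) • B f) (Set.Icc 0 t) s := by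
    intro s _
    exact ((hasDerivAt_exp_smul_apply B f s).sub
      ((hasDerivAt_id s).smul_const (B f))).hasDerivWithinAt
  have hb : ∀ s ∈ Set.Ico (0 : ℝ) t,
      ‖NormedSpace.exp (s • B) (B f) - (1 : ℝ) • B f‖ ≤ 2 * ‖B f - g‖ + ‖B g‖ * t := by
    intro s hs
    have h1 : NormedSpace.exp (s • B) (B f) - (1 : ℝ) • B f
        = NormedSpace.exp (s • B) (B f - g) + (NormedSpace.exp (s • B) g - g) - (B f - g) := by
      rw [map_sub, one_smul]; abel
    rw [h1]
    have h2 := hB.norm_apply_le hs.1 (B f - g)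
    have h3 := hB.norm_exp_sub_self_le hs.1 g
    have h4 : ‖B g‖ * s ≤ ‖B g‖ * t := mul_le_mul_of_nonneg_left hs.2.le (norm_nonneg _)
    calc _ ≤ ‖NormedSpace.exp (s • B) (B f - g) + (NormedSpace.exp (s • B) g - g)‖ + ‖B f - g‖ :=
          norm_sub_le _ _
      _ ≤ ‖NormedSpace.exp (s • B) (B f - g)‖ + ‖NormedSpace.exp (s • B) g - g‖ + ‖B f - g‖ := by
          gcongr; exact norm_add_le _ _
      _ ≤ _ := by linarith
  have := norm_image_sub_le_of_norm_deriv_le_segment' hd hb t (Set.right_mem_Icc.2 ht)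
  simp only [zero_smul, NormedSpace.exp_zero, one_apply_eq_self, sub_zero] at this
  rwa [sub_right_comm]

theorem norm_exp_le_exp_norm [CompleteSpace E] (B : E →L[ℂ] E) :
    ‖NormedSpace.exp B‖ ≤ Real.exp ‖B‖ := by
  rw [NormedSpace.exp_eq_tsum ℝ, Real.exp_eq_exp_ℝ]
  have h := NormedSpace.expSeries_div_hasSum_exp (𝔸 := ℝ) ‖B‖
  refine tsum_of_norm_bounded h fun n => ?_
  rw [norm_smul, norm_inv, Real.norm_natCast, div_eq_inv_mul]
  gcongr
  rcases Nat.eq_zero_or_pos n with rfl | hn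
  · rw [pow_zero, pow_zero]; exact ContinuousLinearMap.norm_id_le
  · exact norm_pow_le' B hn

/-- The scalar part splits off as `e^{-tl}`, which compensates the bound `e^{t l² ‖R‖} ≤ e^{tl}`
exactly. -/
theorem contractiveExp_of_norm_le [CompleteSpace E] {R : E →L[ℂ] E} {l : ℝ}
    (hl : 0 < l) (hR : ‖R‖ ≤ l⁻¹) :
    ContractiveExp ((l ^ 2) • R - l • (1 : E →L[ℂ] E)) := by
  intro t ht
  have h1 : t • ((l ^ 2) • R - l • (1 : E →L[ℂ] E))
      = (t * l ^ 2) • R + algebraMap ℝ (E →L[ℂ] E) (-(t * l)) := by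
    rw [Algebra.algebraMap_eq_smul_one]; module
  let +nondep : NormedAlgebra ℚ (E →L[ℂ] E) := .restrictScalars ℚ ℝ _
  rw [h1, NormedSpace.exp_add_of_commute (Algebra.commute_algebraMap_right _ _),
    ← NormedSpace.algebraMap_exp_comm, Algebra.algebraMap_eq_smul_one, mul_smul_comm, mul_one,
    norm_smul]
  have h2 : ‖NormedSpace.exp ((t * l ^ 2) • R)‖ ≤ Real.exp (t * l) := by
    refine (norm_exp_le_exp_norm ((t * l ^ 2) • R)).trans (Real.exp_le_exp.2 ?_)
    rw [norm_smul, Real.norm_of_nonneg (by positivity)]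
    calc t * l ^ 2 * ‖R‖ ≤ t * l ^ 2 * l⁻¹ := by gcongr
      _ = t * l := by field_simp
  rw [← Real.exp_eq_exp_ℝ, Real.norm_of_nonneg (Real.exp_pos _).le]
  calc _ ≤ Real.exp (-(t * l)) * Real.exp (t * l) := by gcongr
    _ = 1 := by rw [← Real.exp_add]; simp

theorem cauchySeq_of_dense {U : ℕ → E →L[ℂ] E} (hU : ∀ n, ‖U n‖ ≤ 1) {D : Set E} (hD : Dense D)
    (h : ∀ f ∈ D, CauchySeq fun n => U n f) (f : E) : CauchySeq fun n => U n f := by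
  rw [Metric.cauchySeq_iff]
  intro ε hε
  obtain ⟨g, hgD, hg⟩ := Metric.mem_closure_iff.1 (hD f) (ε / 3) (by positivity)
  obtain ⟨n0, hn0⟩ := Metric.cauchySeq_iff.1 (h g hgD) (ε / 3) (by positivity)
  refine ⟨n0, fun m hm n hn => ?_⟩
  have hk : ∀ k, dist (U k f) (U k g) < ε / 3 := by
    intro k
    rw [dist_eq_norm, ← map_sub]
    rw [dist_eq_norm] at hg
    exact (((U k).le_of_opNorm_le (hU k) _).trans_eq (one_mul _)).trans_lt hg
  have h1 := hk m
  have h2 := hk n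
  have h3 := hn0 m hm n hn
  rw [dist_comm] at h2
  linarith [dist_triangle4 (U m f) (U m g) (U n g) (U n f)]

theorem tendsto_of_dense {ι : Type*} {l : Filter ι} {U : ι → E →L[ℂ] E} (hU : ∀ n, ‖U n‖ ≤ 1)
    {D : Set E} (hD : Dense D) (h : ∀ f ∈ D, Tendsto (fun n => U n f) l (𝓝 f)) (f : E) :
    Tendsto (fun n => U n f) l (𝓝 f) := by
  rw [Metric.tendsto_nhds]
  intro ε hε
  obtain ⟨g, hgD, hg⟩ := Metric.mem_closure_iff.1 (hD f) (ε / 3) (by positivity)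
  filter_upwards [Metric.tendsto_nhds.1 (h g hgD) (ε / 3) (by positivity)] with n hn
  have hk : dist (U n f) (U n g) < ε / 3 := by
    rw [dist_eq_norm, ← map_sub]
    rw [dist_eq_norm] at hg
    exact (((U n).le_of_opNorm_le (hU n) _).trans_eq (one_mul _)).trans_lt hg
  rw [dist_comm] at hg
  linarith [dist_triangle4 (U n f) (U n g) g f]

end ContractionExp

/-! ### Dissipative operators and the Lumer-Phillips theorem -/

section LumerPhillips

variable {E : Type*} [NormedAddCommGroup E] [InnerProductSpace ℂ E]

/-- `A` is dissipative. -/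
def IsDissipative (A : E →ₗ.[ℂ] E) : Prop :=
  ∀ f : A.domain, (inner ℂ (f : E) (A f)).re ≤ 0

theorem norm_le_norm_smul_sub {f g : E} (h : (inner ℂ f g).re ≤ 0) (l : ℝ) :
    l * ‖f‖ ≤ ‖(l : ℂ) • f - g‖ := by
  have h1 : l * ‖f‖ ^ 2 ≤ (inner ℂ f ((l : ℂ) • f - g)).re := by
    rw [inner_sub_right, inner_smul_right, Complex.sub_re, inner_self_eq_norm_sq_to_K]
    have : ((l : ℂ) * ((‖f‖ : ℂ)) ^ 2).re = l * ‖f‖ ^ 2 := by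
      rw [← Complex.ofReal_pow, ← Complex.ofReal_mul, Complex.ofReal_re]
    simp only [Complex.coe_algebraMap]
    linarith
  have h2 : (inner ℂ f ((l : ℂ) • f - g)).re ≤ ‖f‖ * ‖(l : ℂ) • f - g‖ :=
    (Complex.re_le_norm _).trans (norm_inner_le_norm _ _)
  rcases (norm_nonneg f).eq_or_lt with h0 | h0
  · rw [← h0, mul_zero]; exact norm_nonneg _
  · nlinarith

theorem IsDissipative.exists_resolvent {A : E →ₗ.[ℂ] E} (hA : IsDissipative A) {l : ℝ}
    (hl : 0 < l) (hr : ∀ g : E, ∃ f : A.domain, (l : ℂ) • (f : E) - A f = g) :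
    ∃ R : E →L[ℂ] E, ‖R‖ ≤ l⁻¹ ∧
      (∀ g, ∃ h : A.domain, (h : E) = R g ∧ A h = (l : ℂ) • R g - g) ∧
      ∀ f : A.domain, R ((l : ℂ) • (f : E) - A f) = f := by
  let T : A.domain →ₗ[ℂ] E := (l : ℂ) • A.domain.subtype - A.toFun
  have hT : ∀ f, T f = (l : ℂ) • (f : E) - A f := fun f => rfl
  have hn : ∀ f : A.domain, l * ‖(f : E)‖ ≤ ‖T f‖ := fun f => norm_le_norm_smul_sub (hA f) l
  have hinj : Function.Injective T := by
    rw [injective_iff_map_eq_zero]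
    intro f hf
    have := hn f
    rw [hf, norm_zero] at this
    have h0 : ‖(f : E)‖ = 0 := le_antisymm (by nlinarith) (norm_nonneg _)
    exact Subtype.ext (norm_eq_zero.1 h0)
  let e := LinearEquiv.ofBijective T ⟨hinj, hr⟩
  have he : ∀ g, T (e.symm g) = g := fun g => e.apply_symm_apply g
  refine ⟨(A.domain.subtype ∘ₗ e.symm.toLinearMap).mkContinuous l⁻¹ ?_, ?_, ?_, ?_⟩
  · intro g
    have := hn (e.symm g)
    rw [he] at this
    rw [inv_mul_eq_div, le_div_iff₀ hl, mul_comm]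
    exact this
  · exact LinearMap.mkContinuous_norm_le _ (inv_nonneg.2 hl.le) _
  · intro g
    refine ⟨e.symm g, rfl, ?_⟩
    have := he g
    rw [hT] at this
    change A (e.symm g) = (l : ℂ) • ((e.symm g : A.domain) : E) - g
    nth_rw 3 [← this]
    abel
  · intro f
    change ((e.symm (T f) : A.domain) : E) = f
    rw [show T f = e f from rfl, e.symm_apply_apply]

theorem C0ContractionSemigroup.re_inner_generator_le (T : C0ContractionSemigroup E) {f g : E}
    (h : Tendsto (fun h : ℝ≥0 => ((h : ℝ) : ℂ)⁻¹ • (T.toFun h f - f)) (𝓝[>] 0) (𝓝 g)) :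
    (inner ℂ f g).re ≤ 0 := by
  have h1 : Tendsto (fun h : ℝ≥0 => (inner ℂ f (((h : ℝ) : ℂ)⁻¹ • (T.toFun h f - f))).re)
      (𝓝[>] 0) (𝓝 (inner ℂ f g).re) :=
    (Complex.continuous_re.tendsto _).comp (tendsto_const_nhds.inner h)
  refine le_of_tendsto h1 (Eventually.of_forall fun t => ?_)
  rw [inner_smul_right, ← Complex.ofReal_inv, Complex.re_ofReal_mul, inner_sub_right,
    Complex.sub_re]
  refine mul_nonpos_of_nonneg_of_nonpos (inv_nonneg.2 t.2) (sub_nonpos.2 ?_)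
  have h2 : (inner ℂ f f).re = ‖f‖ ^ 2 := by
    rw [← inner_self_eq_norm_sq (𝕜 := ℂ)]; rfl
  rw [h2]
  calc _ ≤ ‖f‖ * ‖T.toFun t f‖ := (Complex.re_le_norm _).trans (norm_inner_le_norm _ _)
    _ ≤ ‖f‖ * ‖f‖ := by
      gcongr
      exact ((T.toFun t).le_of_opNorm_le (T.norm_le_one' t) f).trans_eq (one_mul _)
    _ = ‖f‖ ^ 2 := by ring

/-- The Lumer-Phillips theorem in a Hilbert space. -/
theorem IsDissipative.exists_isGenerator [CompleteSpace E] {A : E →ₗ.[ℂ] E}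
    (hA : IsDissipative A) (hd : Dense (A.domain : Set E))
    (hr : ∀ l : ℝ, 0 < l → ∀ g : E, ∃ f : A.domain, (l : ℂ) • (f : E) - A f = g) :
    ∃ T : C0ContractionSemigroup E, T.IsGenerator A := by
  have hl : ∀ n : ℕ, (0 : ℝ) < n + 1 := fun n => by positivity
  choose R hRn hRd hRi using fun n : ℕ => hA.exists_resolvent (hl n) (hr _ (hl n))
  have hRA : ∀ n (f : A.domain), R n (A f) = ((n + 1 : ℝ) : ℂ) • R n f - f := by
    intro n f
    have := hRi n f
    rw [map_sub, map_smul] at this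
    exact eq_sub_of_add_eq (by rw [add_comm]; exact (sub_eq_iff_eq_add.1 this).symm)
  have hcomm : ∀ m n, Commute (R m) (R n) := by
    intro m n
    ext g
    change R m (R n g) = R n (R m g)
    obtain ⟨h, hh, hAh⟩ := hRd n g
    obtain ⟨k, hk, hAk⟩ := hRd m (R n g)
    have h1 : ((n + 1 : ℝ) : ℂ) • (k : E) - A k = R m g := by
      have h2 := hRA m h
      rw [hh] at h2
      rw [hAk, ← h2, hAh, map_sub, map_smul, hk]
      abel
    have h3 := hRi n k
    rw [h1, hk] at h3
    exact h3.symm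
  -- Yosida approximation at `l = n + 1`: on the domain it equals `l R(l) A`, and `l R(l)` tends
  -- strongly to the identity.
  let B : ℕ → E →L[ℂ] E := fun n => ((n + 1 : ℝ) ^ 2) • R n - (n + 1 : ℝ) • (1 : E →L[ℂ] E)
  have hB : ∀ n, ContractiveExp (B n) := fun n => contractiveExp_of_norm_le (hl n) (hRn n)
  have hBcomm : ∀ m n, Commute (B m) (B n) := fun m n =>
    ((((hcomm m n).smul_left _).smul_right _).sub_right
      ((Commute.one_right _).smul_right _)).sub_left (((Commute.one_left _).smul_left _))
  have hBA : ∀ n (f : A.domain), B n f = ((n + 1 : ℝ) • R n) (A f) := by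
    intro n f
    change ((n + 1 : ℝ) ^ 2) • R n f - (n + 1 : ℝ) • (f : E) = (n + 1 : ℝ) • R n (A f)
    rw [hRA, Complex.coe_smul]
    module
  have hRone : ∀ n : ℕ, ‖(n + 1 : ℝ) • R n‖ ≤ 1 := by
    intro n
    rw [norm_smul, Real.norm_of_nonneg (hl n).le]
    calc (n + 1 : ℝ) * ‖R n‖ ≤ (n + 1) * (n + 1 : ℝ)⁻¹ := by gcongr; exact hRn n
      _ = 1 := mul_inv_cancel₀ (hl n).ne'
  have hRlim : ∀ f : E, Tendsto (fun n : ℕ => ((n + 1 : ℝ) • R n) f) atTop (𝓝 f) := by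
    refine tendsto_of_dense hRone hd fun f hf => ?_
    lift f to A.domain using hf
    rw [tendsto_iff_norm_sub_tendsto_zero]
    have h0 : Tendsto (fun n : ℕ => (n + 1 : ℝ)⁻¹ * ‖A f‖) atTop (𝓝 0) := by
      simpa using (tendsto_one_div_add_atTop_nhds_zero_nat (𝕜 := ℝ)).mul_const ‖A f‖
    refine squeeze_zero (fun _ => norm_nonneg _) (fun n => ?_) h0
    have : ((n + 1 : ℝ) • R n) (f : E) - f = R n (A f) := by
      rw [hRA, Complex.coe_smul]; rfl
    rw [this]
    exact (R n).le_of_opNorm_le (hRn n) _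
  have hBlim : ∀ f : A.domain, Tendsto (fun n => B n f) atTop (𝓝 (A f)) := by
    intro f
    simp only [hBA]
    exact hRlim _
  have hcauchy : ∀ t : ℝ≥0, ∀ f : E, CauchySeq fun n => NormedSpace.exp ((t : ℝ) • B n) f := by
    intro t
    refine cauchySeq_of_dense (fun n => hB n t t.2) hd fun f hf => ?_
    lift f to A.domain using hf
    have h1 := (hBlim f).cauchySeq
    rw [Metric.cauchySeq_iff] at h1 ⊢
    intro ε hε
    obtain ⟨n0, hn0⟩ := h1 (ε / (t + 1)) (by positivity)
    refine ⟨n0, fun m hm n hn => ?_⟩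
    have h2 := (hB m).norm_exp_sub_exp_le (hB n) (hBcomm m n) t.2 (f : E)
    have h3 := hn0 m hm n hn
    rw [dist_eq_norm] at h3 ⊢
    rw [lt_div_iff₀ (by positivity)] at h3
    refine h2.trans_lt (lt_of_le_of_lt ?_ h3)
    gcongr
    simp
  choose U hU using fun t f => cauchySeq_tendsto_of_complete (hcauchy t f)
  let T : ℝ≥0 → E →L[ℂ] E := fun t =>
    LinearMap.mkContinuous
      { toFun := U t
        map_add' := fun f g => tendsto_nhds_unique (hU t (f + g)) <| by
          simpa only [map_add] using (hU t f).add (hU t g)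
        map_smul' := fun c f => tendsto_nhds_unique (hU t (c • f)) <| by
          simpa only [map_smul, RingHom.id_apply] using (hU t f).const_smul c } 1 fun f => by
      rw [one_mul]
      exact le_of_tendsto (hU t f).norm (Eventually.of_forall fun n =>
        (hB n).norm_apply_le t.2 f)
  have hT : ∀ (t : ℝ≥0) (f : E), Tendsto (fun n => NormedSpace.exp ((t : ℝ) • B n) f) atTop (𝓝 (T t f)) :=
    hU
  have hT1 : ∀ t : ℝ≥0, ‖T t‖ ≤ 1 := fun t => LinearMap.mkContinuous_norm_le _ zero_le_one _
  have hT0 : ∀ (f : A.domain) (t : ℝ≥0), ‖T t f - f‖ ≤ ‖A f‖ * t := fun f t =>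
    le_of_tendsto_of_tendsto' ((hT t f).sub_const (f : E)).norm
      ((hBlim f).norm.mul_const (t : ℝ)) fun n => (hB n).norm_exp_sub_self_le t.2 f
  have hTd : ∀ (f g : A.domain) (t : ℝ≥0),
      ‖T t f - f - (t : ℝ) • A f‖ ≤ (2 * ‖A f - g‖ + ‖A g‖ * t) * t := fun f g t =>
    le_of_tendsto_of_tendsto' (((hT t f).sub_const (f : E)).sub ((hBlim f).const_smul (t : ℝ))).norm
      (((((hBlim f).sub_const (g : E)).norm.const_mul 2).add
        ((hBlim g).norm.mul_const (t : ℝ))).mul_const (t : ℝ))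
      fun n => (hB n).norm_exp_sub_sub_le t.2 f g
  let S : C0ContractionSemigroup E :=
    { toFun := T
      map_zero' := by
        ext f
        refine tendsto_nhds_unique (hT 0 f) ?_
        simp
      map_add' := by
        intro s t
        ext f
        refine tendsto_nhds_unique (hT (s + t) f) ?_
        have e : ∀ n, NormedSpace.exp (((s + t : ℝ≥0) : ℝ) • B n) f
            = NormedSpace.exp ((s : ℝ) • B n) (NormedSpace.exp ((t : ℝ) • B n) f) := by
          intro n
          let +nondep : NormedAlgebra ℚ (E →L[ℂ] E) := .restrictScalars ℚ ℝ _
          rw [NNReal.coe_add, add_smul, NormedSpace.exp_add_of_commute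
            (((Commute.refl _).smul_left _).smul_right _)]
          rfl
        simp only [e]
        rw [tendsto_iff_norm_sub_tendsto_zero]
        have h1 := (hT s (T t f))
        have h2 := (hT t f)
        rw [tendsto_iff_norm_sub_tendsto_zero] at h1 h2
        have h3 := h2.add h1
        rw [add_zero] at h3
        refine squeeze_zero (fun _ => norm_nonneg _) (fun n => ?_) h3
        have h4 := (hB n).norm_apply_le s.2 (NormedSpace.exp ((t : ℝ) • B n) f - T t f)
        rw [map_sub] at h4
        exact (norm_sub_le_norm_sub_add_norm_sub _ _ _).trans (add_le_add_left h4 _)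
      tendsto_zero' := by
        refine tendsto_of_dense hT1 hd fun f hf => ?_
        lift f to A.domain using hf
        rw [tendsto_iff_norm_sub_tendsto_zero]
        refine squeeze_zero (fun _ => norm_nonneg _) (hT0 f) ?_
        have : Tendsto (fun t : ℝ≥0 => ‖A f‖ * (t : ℝ)) (𝓝 0) (𝓝 (‖A f‖ * ((0 : ℝ≥0) : ℝ))) :=
          (NNReal.continuous_coe.tendsto 0).const_mul _
        simpa using this
      norm_le_one' := hT1 }
  have hgen : ∀ f : A.domain,
      Tendsto (fun h : ℝ≥0 => ((h : ℝ) : ℂ)⁻¹ • (T h f - f)) (𝓝[>] 0) (𝓝 (A f)) := by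
    intro f
    rw [Metric.tendsto_nhds]
    intro ε hε
    -- `A f` need not lie in the domain; a nearby `g` in the domain makes the remainder bound `hTd`
    -- small.
    obtain ⟨g, hg, hfg⟩ := Metric.mem_closure_iff.1 (hd (A f)) (ε / 3) (by positivity)
    lift g to A.domain using hg
    rw [dist_eq_norm] at hfg
    have hev : ∀ᶠ t : ℝ≥0 in 𝓝[>] 0, ‖A g‖ * t < ε / 3 := by
      refine Filter.Eventually.filter_mono nhdsWithin_le_nhds ?_
      have : Tendsto (fun t : ℝ≥0 => ‖A g‖ * (t : ℝ)) (𝓝 0) (𝓝 (‖A g‖ * ((0 : ℝ≥0) : ℝ))) :=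
        (NNReal.continuous_coe.tendsto 0).const_mul _
      refine this.eventually_lt_const ?_
      simpa using hε
    filter_upwards [hev, self_mem_nhdsWithin] with t ht ht0
    have ht0' : (0 : ℝ) < t := ht0
    have e : ((t : ℝ) : ℂ)⁻¹ • (T t f - f) - A f
        = ((t : ℝ)⁻¹ : ℝ) • (T t f - f - (t : ℝ) • A f) := by
      rw [smul_sub _ _ ((t : ℝ) • A f), inv_smul_smul₀ ht0'.ne', ← Complex.ofReal_inv,
        Complex.coe_smul]
    rw [dist_eq_norm, e, norm_smul, norm_inv, Real.norm_of_nonneg ht0'.le]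
    have h5 := hTd f g t
    rw [inv_mul_lt_iff₀ ht0']
    nlinarith
  refine ⟨S, fun f g => ⟨fun h => ?_, fun h => ?_⟩⟩
  · obtain ⟨u, hu, hu'⟩ := (LinearPMap.mem_graph_iff A).1 h
    dsimp only at hu hu'
    rw [← hu, ← hu']
    exact hgen u
  -- Maximality: with `u - A u = f - g`, the difference `f - u` is an eigenvector with eigenvalue
  -- `1` of the generator unless it is zero, and generators of contraction semigroups are
  -- dissipative.
  · obtain ⟨u, hu⟩ := hr 1 one_pos (f - g)
    have h1 : Tendsto (fun h : ℝ≥0 => ((h : ℝ) : ℂ)⁻¹ • (T h (f - u) - (f - u))) (𝓝[>] 0)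
        (𝓝 (g - A u)) := by
      refine (h.sub (hgen u)).congr fun t => ?_
      rw [← smul_sub]
      congr 1
      rw [map_sub]
      change T t f - f - _ = _
      abel
    have h2 := norm_le_norm_smul_sub (S.re_inner_generator_le h1) 1
    rw [Complex.ofReal_one, one_smul] at h2 hu
    have h3 : f - u - (g - A u) = 0 := by
      rw [sub_sub_sub_comm, hu, sub_self]
    rw [h3, norm_zero, one_mul] at h2
    have h4 : f = u := sub_eq_zero.1 (norm_le_zero_iff.1 h2)
    have h5 : g = A u := by
      rw [h4, sub_self, zero_sub, neg_eq_zero] at h3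
      exact sub_eq_zero.1 h3
    rw [h4, h5]
    exact A.mem_graph u

end LumerPhillips

/-! ### Position and derivative operators on Schwartz functions -/

namespace QuasiFree

/-- Schwartz functions on `ℝ^d`. -/
abbrev Schw (d : ℕ) : Type := 𝓢(Space d, ℂ)

variable {d : ℕ}

/-- The embedding of Schwartz functions into `L²`. -/
def toL2 (d : ℕ) : Schw d →L[ℂ] L2 d := SchwartzMap.toLpCLM ℂ ℂ 2 volume

/-- Multiplication of Schwartz functions by a coordinate function. -/
def schX (k : Fin d) : Schw d →L[ℂ] Schw d :=
  SchwartzMap.smulLeftCLM ℂ (fun x : Space d => ((x k : ℝ) : ℂ))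

/-- The partial derivatives of Schwartz functions. -/
def schD (k : Fin d) : Schw d →L[ℂ] Schw d :=
  LineDeriv.lineDerivOpCLM ℂ (Schw d) (EuclideanSpace.single k (1 : ℝ) : Space d)

theorem schX_apply (k : Fin d) (f : Schw d) (x : Space d) : schX k f x = (x k : ℂ) * f x := by
  rw [schX, SchwartzMap.smulLeftCLM_apply_apply (coord_hasTemperateGrowth k), smul_eq_mul]

theorem schD_apply (k : Fin d) (f : Schw d) (x : Space d) :
    schD k f x = fderiv ℝ f x (EuclideanSpace.single k (1 : ℝ)) :=
  SchwartzMap.lineDerivOp_apply_eq_fderiv _ f x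

/-! ### Commutation relations -/

theorem schX_comm (k l : Fin d) (f : Schw d) : schX k (schX l f) = schX l (schX k f) := by
  ext x
  simp only [schX_apply]
  ring

theorem schD_comm (k l : Fin d) (f : Schw d) : schD k (schD l f) = schD l (schD k f) := by
  ext x
  have h : ∀ m, (fun y => schD m f y)
      = fun y => fderiv ℝ f y (EuclideanSpace.single m (1 : ℝ)) := fun m => funext (schD_apply m f)
  have hd : Differentiable ℝ (fderiv ℝ f) :=
    ((f.smooth 2).fderiv_right (m := 1) (by norm_num)).differentiable (by norm_num)
  have h2 : ∀ m n : Fin d, schD n (schD m f) x = fderiv ℝ (fderiv ℝ f) x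
      (EuclideanSpace.single n (1 : ℝ)) (EuclideanSpace.single m (1 : ℝ)) := by
    intro m n
    rw [schD_apply]
    change fderiv ℝ (fun y => schD m f y) x _ = _
    rw [h m, fderiv_clm_apply (hd x) (differentiableAt_const _)]
    simp
  rw [h2, h2]
  have hs : IsSymmSndFDerivAt ℝ (f : Space d → ℂ) x :=
    (f.smooth 2).contDiffAt.isSymmSndFDerivAt (by simp)
  exact hs _ _

theorem schD_schX (k l : Fin d) (f : Schw d) :
    schD k (schX l f) = schX l (schD k f) + if k = l then f else 0 := by
  ext x
  rw [schD_apply]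
  have h : (schX l f : Space d → ℂ) = fun y => ((y l : ℝ) : ℂ) * f y := funext (schX_apply l f)
  have hx : HasFDerivAt (fun y : Space d => ((y l : ℝ) : ℂ))
      (Complex.ofRealCLM ∘L (EuclideanSpace.proj l : Space d →L[ℝ] ℝ)) x :=
    (Complex.ofRealCLM ∘L (EuclideanSpace.proj l : Space d →L[ℝ] ℝ)).hasFDerivAt
  have hm : HasFDerivAt (fun y : Space d => ((y l : ℝ) : ℂ) * f y) _ x := hx.mul (f.hasFDerivAt x)
  rw [h, hm.fderiv]
  have h3 : ((if k = l then f else 0 : Schw d)) x = if k = l then f x else 0 := by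
    split_ifs <;> rfl
  change _ = schX l (schD k f) x + (if k = l then f else 0 : Schw d) x
  rw [schX_apply, schD_apply, h3]
  by_cases hkl : k = l
  · subst hkl; simp
  · simp [hkl, Ne.symm hkl]

/-! ### Formal adjoints -/

/-- `W'` is a formal adjoint of `W` on Schwartz functions. -/
def IsFormalAdj (W W' : Schw d →L[ℂ] Schw d) : Prop :=
  ∀ f g, inner ℂ (toL2 d (W f)) (toL2 d g) = inner ℂ (toL2 d f) (toL2 d (W' g))

theorem inner_toL2 (f g : Schw d) :
    inner ℂ (toL2 d f) (toL2 d g) = ∫ x, (starRingEnd ℂ (f x)) * g x := by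
  refine (SchwartzMap.inner_toL2_toL2_eq f g volume).trans ?_
  simp only [RCLike.inner_apply, mul_comm]

theorem isFormalAdj_schX (k : Fin d) : IsFormalAdj (schX k) (schX k) := by
  intro f g
  rw [inner_toL2, inner_toL2]
  congr 1
  ext x
  rw [schX_apply, schX_apply, map_mul, Complex.conj_ofReal]
  ring

/-- Integration by parts for the real bilinear pairing `(z, w) ↦ z̄ w`. -/
theorem isFormalAdj_schD (k : Fin d) : IsFormalAdj (schD k) (-schD k) := by
  intro f g
  have h := SchwartzMap.integral_bilinear_lineDerivOp_right_eq_neg_left (μ := volume) f g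
    ((ContinuousLinearMap.mul ℝ ℂ) ∘L (Complex.conjCLE : ℂ →L[ℝ] ℂ))
    (EuclideanSpace.single k (1 : ℝ) : Space d)
  rw [neg_apply, map_neg, inner_neg_right, inner_toL2, inner_toL2]
  exact (neg_eq_iff_eq_neg.2 h).symm

theorem IsFormalAdj.symm {W W' : Schw d →L[ℂ] Schw d} (h : IsFormalAdj W W') :
    IsFormalAdj W' W := by
  intro f g
  rw [← inner_conj_symm, ← h g f, inner_conj_symm]

theorem IsFormalAdj.add {W W' V V' : Schw d →L[ℂ] Schw d} (h : IsFormalAdj W W')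
    (h' : IsFormalAdj V V') : IsFormalAdj (W + V) (W' + V') := by
  intro f g
  simp only [add_apply, map_add, inner_add_left, inner_add_right, h f g,
    h' f g]

theorem IsFormalAdj.neg {W W' : Schw d →L[ℂ] Schw d} (h : IsFormalAdj W W') :
    IsFormalAdj (-W) (-W') := by
  intro f g
  simp only [neg_apply, map_neg, inner_neg_left, inner_neg_right, h f g]

theorem IsFormalAdj.sub {W W' V V' : Schw d →L[ℂ] Schw d} (h : IsFormalAdj W W')
    (h' : IsFormalAdj V V') : IsFormalAdj (W - V) (W' - V') := by
  rw [sub_eq_add_neg, sub_eq_add_neg]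
  exact h.add h'.neg

theorem IsFormalAdj.smul {W W' : Schw d →L[ℂ] Schw d} (h : IsFormalAdj W W') (c : ℂ) :
    IsFormalAdj (c • W) (starRingEnd ℂ c • W') := by
  intro f g
  simp only [smul_apply, map_smul, inner_smul_left, inner_smul_right, h f g]

theorem IsFormalAdj.comp {W W' V V' : Schw d →L[ℂ] Schw d} (h : IsFormalAdj W W')
    (h' : IsFormalAdj V V') : IsFormalAdj (W ∘L V) (V' ∘L W') := by
  intro f g
  exact (h _ _).trans (h' _ _)

theorem isFormalAdj_id : IsFormalAdj (ContinuousLinearMap.id ℂ (Schw d))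
    (ContinuousLinearMap.id ℂ (Schw d)) := fun _ _ => rfl

theorem isFormalAdj_sum {ι : Type*} (s : Finset ι) {W W' : ι → Schw d →L[ℂ] Schw d}
    (h : ∀ i ∈ s, IsFormalAdj (W i) (W' i)) : IsFormalAdj (∑ i ∈ s, W i) (∑ i ∈ s, W' i) := by
  intro f g
  simp only [sum_apply, map_sum, sum_inner, inner_sum]
  exact Finset.sum_congr rfl fun i hi => h i hi f g

/-! ### Compatibility with operators on distributions -/

/-- `P` extends `W` from Schwartz functions to distributions. -/
def Extends (P : Distr d →L[ℂ] Distr d) (W : Schw d →L[ℂ] Schw d) : Prop :=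
  ∀ f : Schw d, P (Lp.toTemperedDistribution (toL2 d f)) = Lp.toTemperedDistribution (toL2 d (W f))

/-- The embedding of `L²` into distributions. -/
def toDistr (d : ℕ) : L2 d →L[ℂ] Distr d := Lp.toTemperedDistributionCLM ℂ volume 2

theorem extends_iff (P : Distr d →L[ℂ] Distr d) (W : Schw d →L[ℂ] Schw d) :
    Extends P W ↔ ∀ f, P (toDistr d (toL2 d f)) = toDistr d (toL2 d (W f)) := Iff.rfl

theorem Extends.add {P Q : Distr d →L[ℂ] Distr d} {W V : Schw d →L[ℂ] Schw d}
    (h : Extends P W) (h' : Extends Q V) : Extends (P + Q) (W + V) := by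
  rw [extends_iff] at *
  intro f
  simp only [add_apply, map_add, h f, h' f]

theorem Extends.sub {P Q : Distr d →L[ℂ] Distr d} {W V : Schw d →L[ℂ] Schw d}
    (h : Extends P W) (h' : Extends Q V) : Extends (P - Q) (W - V) := by
  rw [extends_iff] at *
  intro f
  simp only [sub_apply, map_sub, h f, h' f]

theorem Extends.neg {P : Distr d →L[ℂ] Distr d} {W : Schw d →L[ℂ] Schw d}
    (h : Extends P W) : Extends (-P) (-W) := by
  rw [extends_iff] at *
  intro f
  simp only [neg_apply, map_neg, h f]

theorem Extends.smul {P : Distr d →L[ℂ] Distr d} {W : Schw d →L[ℂ] Schw d}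
    (h : Extends P W) (c : ℂ) : Extends (c • P) (c • W) := by
  rw [extends_iff] at *
  intro f
  simp only [smul_apply, map_smul, h f]

theorem Extends.comp {P Q : Distr d →L[ℂ] Distr d} {W V : Schw d →L[ℂ] Schw d}
    (h : Extends P W) (h' : Extends Q V) : Extends (P ∘L Q) (W ∘L V) := by
  rw [extends_iff] at *
  intro f
  simp only [ContinuousLinearMap.comp_apply, h (V f), h' f]

theorem extends_id : Extends (ContinuousLinearMap.id ℂ (Distr d))
    (ContinuousLinearMap.id ℂ (Schw d)) := fun _ => rfl

theorem extends_sum {ι : Type*} (s : Finset ι) {P : ι → Distr d →L[ℂ] Distr d}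
    {W : ι → Schw d →L[ℂ] Schw d} (h : ∀ i ∈ s, Extends (P i) (W i)) :
    Extends (∑ i ∈ s, P i) (∑ i ∈ s, W i) := by
  simp only [extends_iff] at *
  intro f
  simp only [sum_apply, map_sum]
  exact Finset.sum_congr rfl fun i hi => h i hi f

theorem toDistr_toL2 (f : Schw d) :
    Lp.toTemperedDistribution (toL2 d f) = SchwartzMap.toTemperedDistributionCLM _ _ volume f :=
  Lp.toTemperedDistribution_toLp_eq f

theorem extends_coordMul (k : Fin d) : Extends (coordMul k) (schX k) := by
  intro f
  rw [toDistr_toL2, toDistr_toL2]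
  ext φ
  rw [coordMul, TemperedDistribution.smulLeftCLM_apply_apply]
  refine (SchwartzMap.toTemperedDistributionCLM_apply_apply volume _ _).trans
    (Eq.trans ?_ (SchwartzMap.toTemperedDistributionCLM_apply_apply volume _ _).symm)
  congr 1
  ext x
  rw [schX_apply, SchwartzMap.smulLeftCLM_apply_apply (coord_hasTemperateGrowth k)]
  simp only [smul_eq_mul]
  ring

theorem extends_partialD (k : Fin d) : Extends (partialD k) (schD k) := by
  intro f
  rw [toDistr_toL2, toDistr_toL2]
  exact TemperedDistribution.lineDerivOp_toTemperedDistributionCLM_eq f _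

/-- The harmonic oscillator `∑ₖ (xₖ² - ∂ₖ²)` on Schwartz functions. -/
def schOsc (d : ℕ) : Schw d →L[ℂ] Schw d := ∑ k : Fin d, (schX k ∘L schX k - schD k ∘L schD k)

theorem normSqMul_apply (T : Distr d) (φ : Schw d) :
    normSqMul d T φ = T (∑ k, schX k (schX k φ)) := by
  rw [normSqMul, TemperedDistribution.smulLeftCLM_apply_apply]
  congr 1
  ext x
  rw [SchwartzMap.smulLeftCLM_apply_apply (normSq_hasTemperateGrowth d),
    sum_apply]
  simp only [schX_apply, EuclideanSpace.norm_sq_eq, smul_eq_mul, Real.norm_eq_abs, sq_abs]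
  push_cast
  rw [Finset.sum_mul]
  exact Finset.sum_congr rfl fun k _ => by ring

theorem laplace_apply (T : Distr d) (φ : Schw d) :
    laplace d T φ = T (∑ k, schD k (schD k φ)) := by
  rw [laplace, TemperedDistribution.laplacianCLM_apply, TemperedDistribution.laplacian_apply_apply,
    SchwartzMap.laplacian_eq_sum (EuclideanSpace.basisFun (Fin d) ℝ)]
  simp only [EuclideanSpace.basisFun_apply]
  rfl

theorem normSqMul_sub_laplace_apply (T : Distr d) (φ : Schw d) :
    (normSqMul d - laplace d) T φ = T (schOsc d φ) := by
  rw [sub_apply]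
  change normSqMul d T φ - laplace d T φ = _
  rw [normSqMul_apply, laplace_apply, ← map_sub, ← Finset.sum_sub_distrib, schOsc,
    sum_apply]
  rfl

theorem extends_normSqMul : Extends (normSqMul d) (∑ k : Fin d, schX k ∘L schX k) := by
  have h := extends_sum Finset.univ fun (k : Fin d) _ =>
    (extends_coordMul k).comp (extends_coordMul k)
  intro f
  rw [← h f]
  ext φ
  rw [normSqMul_apply, map_sum, sum_apply, sum_apply]
  rfl

theorem extends_laplace : Extends (laplace d) (∑ k : Fin d, schD k ∘L schD k) := by
  have h := extends_sum Finset.univ fun (k : Fin d) _ =>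
    (extends_partialD k).comp (extends_partialD k)
  intro f
  rw [← h f, laplace, TemperedDistribution.laplacianCLM_apply,
    TemperedDistribution.laplacian_eq_sum (EuclideanSpace.basisFun (Fin d) ℝ),
    sum_apply]
  simp only [EuclideanSpace.basisFun_apply]
  rfl

/-! ### Complex conjugation -/

/-- Complex conjugation of Schwartz functions. -/
def schConj (d : ℕ) : Schw d →L[ℝ] Schw d :=
  SchwartzMap.postcompCLM (Complex.conjCLE : ℂ →L[ℝ] ℂ)

theorem schConj_apply (f : Schw d) (x : Space d) : schConj d f x = starRingEnd ℂ (f x) := rfl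

theorem schX_schConj (k : Fin d) (f : Schw d) : schX k (schConj d f) = schConj d (schX k f) := by
  ext x
  rw [schX_apply, schConj_apply, schConj_apply, schX_apply, map_mul, Complex.conj_ofReal]

theorem schD_schConj (k : Fin d) (f : Schw d) : schD k (schConj d f) = schConj d (schD k f) := by
  ext x
  rw [schD_apply, schConj_apply, schD_apply]
  have hc : HasFDerivAt (schConj d f : Space d → ℂ) _ x :=
    (Complex.conjCLE : ℂ →L[ℝ] ℂ).hasFDerivAt.comp x (f.hasFDerivAt x)
  rw [hc.fderiv]
  rfl

theorem schOsc_schConj (f : Schw d) : schOsc d (schConj d f) = schConj d (schOsc d f) := by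
  simp only [schOsc, sum_apply, map_sum, sub_apply, map_sub,
    ContinuousLinearMap.comp_apply, schX_schConj, schD_schConj]

/-- Distributions pair bilinearly with test functions while the scalar product is conjugate-linear
in its first slot, hence the conjugation. It is harmless later because the oscillator has real
coefficients. -/
theorem inner_toL2_left (h : Schw d) (f : L2 d) :
    inner ℂ (toL2 d h) f = Lp.toTemperedDistribution f (schConj d h) := by
  rw [Lp.toTemperedDistribution_apply, L2.inner_def]
  refine integral_congr_ae ?_
  filter_upwards [h.coeFn_toLp 2 volume] with x hx
  rw [RCLike.inner_apply, schConj_apply, smul_eq_mul, mul_comm]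
  congr 2

/-- If `(|x|² - Δ) f = g` with `f, g ∈ L²`, then `g` is also obtained weakly by testing against
Schwartz functions. -/
theorem inner_schOsc_left {f g : L2 d} (h : (normSqMul d - laplace d) (Lp.toTemperedDistribution f)
    = Lp.toTemperedDistribution g) (φ : Schw d) :
    inner ℂ (toL2 d (schOsc d φ)) f = inner ℂ (toL2 d φ) g := by
  rw [inner_toL2_left, inner_toL2_left, ← h, normSqMul_sub_laplace_apply, schOsc_schConj]

/-! ### Ladder operators -/

/-- The annihilation operators `xₖ + ∂ₖ` on Schwartz functions. -/
def schA (k : Fin d) : Schw d →L[ℂ] Schw d := schX k + schD k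

/-- The creation operators `xₖ - ∂ₖ` on Schwartz functions. -/
def schC (k : Fin d) : Schw d →L[ℂ] Schw d := schX k - schD k

/-- The number operator `∑ₖ (xₖ - ∂ₖ) (xₖ + ∂ₖ)` on Schwartz functions. -/
def schNum (d : ℕ) : Schw d →L[ℂ] Schw d := ∑ k : Fin d, schC k ∘L schA k

theorem schA_apply (k : Fin d) (f : Schw d) : schA k f = schX k f + schD k f := rfl

theorem schC_apply (k : Fin d) (f : Schw d) : schC k f = schX k f - schD k f := rfl

theorem schNum_apply (f : Schw d) : schNum d f = ∑ k, schC k (schA k f) := by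
  rw [schNum, sum_apply]; rfl

theorem schX_eq (k : Fin d) : schX k = (1 / 2 : ℂ) • (schA k + schC k) := by
  rw [schA, schC]; module

theorem schD_eq (k : Fin d) : schD k = (1 / 2 : ℂ) • (schA k - schC k) := by
  rw [schA, schC]; module

theorem isFormalAdj_schA (k : Fin d) : IsFormalAdj (schA k) (schC k) := by
  rw [schC, sub_eq_add_neg]
  exact (isFormalAdj_schX k).add (isFormalAdj_schD k)

theorem schA_comm (k l : Fin d) (f : Schw d) : schA k (schA l f) = schA l (schA k f) := by
  simp only [schA_apply, map_add, schX_comm k l, schD_comm k l, schD_schX]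
  simp only [eq_comm (a := k) (b := l)]
  abel

/-- Canonical commutation relations without the factor `1/√2`; this is why `2` appears here and the
bound for the number operator on degree `n` is `2n`. -/
theorem schA_schC (k l : Fin d) (f : Schw d) :
    schA k (schC l f) = schC l (schA k f) + if k = l then (2 : ℂ) • f else 0 := by
  simp only [schA_apply, schC_apply, map_add, map_sub, schX_comm k l, schD_comm k l, schD_schX]
  by_cases h : k = l
  · subst h
    simp only [if_true]
    module
  · simp only [h, Ne.symm h, if_false]
    abel

theorem schA_schNum (k : Fin d) (f : Schw d) :
    schA k (schNum d f) = schNum d (schA k f) + (2 : ℂ) • schA k f := by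
  simp only [schNum_apply, map_sum, schA_schC, Finset.sum_add_distrib, Finset.sum_ite_eq,
    Finset.mem_univ, if_true, schA_comm k]

theorem schOsc_apply (f : Schw d) : schOsc d f = schNum d f + (d : ℂ) • f := by
  rw [schOsc, sum_apply, schNum_apply]
  have : ∀ k : Fin d, (schX k ∘L schX k - schD k ∘L schD k) f = schC k (schA k f) + f := by
    intro k
    simp only [sub_apply, ContinuousLinearMap.comp_apply, schA_apply, schC_apply, map_add,
      schD_schX, if_true]
    abel
  simp only [this, Finset.sum_add_distrib, Finset.sum_const, Finset.card_univ, Fintype.card_fin]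
  rw [← Nat.cast_smul_eq_nsmul ℂ]

theorem inner_schNum (f g : Schw d) :
    inner ℂ (toL2 d f) (toL2 d (schNum d g))
      = ∑ k, inner ℂ (toL2 d (schA k f)) (toL2 d (schA k g)) := by
  simp only [schNum_apply, map_sum, inner_sum, isFormalAdj_schA _ f]

theorem isFormalAdj_schNum : IsFormalAdj (schNum d) (schNum d) :=
  isFormalAdj_sum _ fun k _ => (isFormalAdj_schA k).symm.comp (isFormalAdj_schA k)

theorem inner_self_toL2 (f : L2 d) : inner ℂ f f = ((‖f‖ ^ 2 : ℝ) : ℂ) := by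
  rw [inner_self_eq_norm_sq_to_K]; simp

theorem sum_norm_schA_sq (f : Schw d) :
    ((∑ k, ‖toL2 d (schA k f)‖ ^ 2 : ℝ) : ℂ) = inner ℂ (toL2 d f) (toL2 d (schNum d f)) := by
  simp only [inner_schNum, inner_self_toL2, Complex.ofReal_sum]

/-- Write `‖N f‖² = ∑ ⟨Aₖ N f, Aₖ f⟩`, move `Aₖ` past `N` with `Aₖ N = N Aₖ + 2 Aₖ`, and expand `⟨N
h, h⟩` as `∑ ‖Aₗ h‖²` for `h = Aₖ f`. All terms are nonnegative, so each product of two annihilators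
is dominated by `N`. -/
theorem norm_schNum_sq (f : Schw d) :
    ‖toL2 d (schNum d f)‖ ^ 2 = ∑ k, ∑ l, ‖toL2 d (schA l (schA k f))‖ ^ 2
      + 2 * ∑ k, ‖toL2 d (schA k f)‖ ^ 2 := by
  apply Complex.ofReal_injective
  rw [← inner_self_toL2, inner_schNum]
  simp only [schA_schNum, map_add, map_smul, inner_add_left, inner_smul_left, isFormalAdj_schNum _,
    Finset.sum_add_distrib, ← sum_norm_schA_sq, inner_self_toL2]
  push_cast
  rw [Finset.mul_sum]
  simp only [map_ofNat]

theorem norm_schA_schA_le (k l : Fin d) (f : Schw d) :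
    ‖toL2 d (schA l (schA k f))‖ ≤ ‖toL2 d (schNum d f)‖ := by
  refine le_of_sq_le_sq ?_ (norm_nonneg _)
  rw [norm_schNum_sq]
  have h1 : ‖toL2 d (schA l (schA k f))‖ ^ 2 ≤ ∑ l, ‖toL2 d (schA l (schA k f))‖ ^ 2 :=
    Finset.single_le_sum (f := fun l => ‖toL2 d (schA l (schA k f))‖ ^ 2)
      (fun _ _ => by positivity) (Finset.mem_univ l)
  have h2 : ∑ l, ‖toL2 d (schA l (schA k f))‖ ^ 2
      ≤ ∑ k, ∑ l, ‖toL2 d (schA l (schA k f))‖ ^ 2 :=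
    Finset.single_le_sum (f := fun k => ∑ l, ‖toL2 d (schA l (schA k f))‖ ^ 2)
      (fun _ _ => by positivity) (Finset.mem_univ k)
  have h3 : 0 ≤ 2 * ∑ k, ‖toL2 d (schA k f)‖ ^ 2 := by positivity
  linarith

theorem norm_schA_le (k : Fin d) (f : Schw d) :
    ‖toL2 d (schA k f)‖ ≤ ‖toL2 d (schNum d f)‖ := by
  refine le_of_sq_le_sq ?_ (norm_nonneg _)
  rw [norm_schNum_sq]
  have h1 : ‖toL2 d (schA k f)‖ ^ 2 ≤ ∑ k, ‖toL2 d (schA k f)‖ ^ 2 :=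
    Finset.single_le_sum (f := fun k => ‖toL2 d (schA k f)‖ ^ 2)
      (fun _ _ => by positivity) (Finset.mem_univ k)
  have h2 : (0 : ℝ) ≤ ∑ k : Fin d, ∑ l : Fin d, ‖toL2 d (schA l (schA k f))‖ ^ 2 :=
    Finset.sum_nonneg fun _ _ => Finset.sum_nonneg fun _ _ => sq_nonneg _
  linarith [sq_nonneg ‖toL2 d (schA k f)‖]

/-- The commutator gives `‖Cₖ f‖² = ‖Aₖ f‖² + 2 ‖f‖²`, so creation operators can be traded for
annihilation operators in estimates. -/
theorem norm_schC_le (k : Fin d) (f : Schw d) :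
    ‖toL2 d (schC k f)‖ ≤ ‖toL2 d (schA k f)‖ + 2 * ‖toL2 d f‖ := by
  have h : ‖toL2 d (schC k f)‖ ^ 2 = ‖toL2 d (schA k f)‖ ^ 2 + 2 * ‖toL2 d f‖ ^ 2 := by
    apply Complex.ofReal_injective
    rw [← inner_self_toL2, (isFormalAdj_schA k).symm f (schC k f), schA_schC, if_pos rfl, map_add,
      inner_add_right, ← isFormalAdj_schA k f, map_smul, inner_smul_right, inner_self_toL2,
      inner_self_toL2]
    push_cast
    ring
  refine le_of_sq_le_sq ?_ (by positivity)
  rw [h]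
  nlinarith [norm_nonneg (toL2 d (schA k f)), norm_nonneg (toL2 d f),
    mul_nonneg (norm_nonneg (toL2 d (schA k f))) (norm_nonneg (toL2 d f)),
    sq_nonneg ‖toL2 d f‖]

/-! ### Operators bounded relative to the number operator -/

/-- Operators on Schwartz functions that are bounded relative to the number operator. -/
def numBounded (d : ℕ) : Submodule ℂ (Schw d →L[ℂ] Schw d) where
  carrier := {W | ∃ C : ℝ, ∀ f, ‖toL2 d (W f)‖ ≤ C * (‖toL2 d (schNum d f)‖ + ‖toL2 d f‖)}
  add_mem' := by
    rintro W V ⟨C, hC⟩ ⟨C', hC'⟩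
    refine ⟨C + C', fun f => ?_⟩
    rw [add_apply, map_add, add_mul]
    exact (norm_add_le _ _).trans (add_le_add (hC f) (hC' f))
  zero_mem' := ⟨0, fun f => by simp⟩
  smul_mem' := by
    rintro c W ⟨C, hC⟩
    refine ⟨‖c‖ * C, fun f => ?_⟩
    rw [smul_apply, map_smul, norm_smul, mul_assoc]
    gcongr
    exact hC f

/-- Generators of the operators of first order. -/
def ladderGen (d : ℕ) : Set (Schw d →L[ℂ] Schw d) :=
  Set.range schA ∪ Set.range schC ∪ {ContinuousLinearMap.id ℂ (Schw d)}

/-- Differential operators `α · x + β · ∇ + γ` on Schwartz functions. -/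
def firstOrder (d : ℕ) : Submodule ℂ (Schw d →L[ℂ] Schw d) := Submodule.span ℂ (ladderGen d)

/-- The span of the products of two operators of first order. -/
def secondOrder (d : ℕ) : Submodule ℂ (Schw d →L[ℂ] Schw d) :=
  Submodule.span ℂ {U | ∃ W ∈ firstOrder d, ∃ V ∈ firstOrder d, U = W ∘L V}

theorem id_mem_numBounded : ContinuousLinearMap.id ℂ (Schw d) ∈ numBounded d :=
  ⟨1, fun f => by
    rw [one_mul]
    exact le_add_of_nonneg_left (norm_nonneg _)⟩

theorem schA_mem_numBounded (k : Fin d) : schA k ∈ numBounded d :=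
  ⟨1, fun f => by
    have := norm_schA_le k f
    have := norm_nonneg (toL2 d f)
    linarith⟩

theorem schC_mem_numBounded (k : Fin d) : schC k ∈ numBounded d :=
  ⟨2, fun f => by
    have := norm_schA_le k f
    have := norm_schC_le k f
    have := norm_nonneg (toL2 d (schNum d f))
    linarith⟩

theorem schC_comp_mem_numBounded {k : Fin d} {W : Schw d →L[ℂ] Schw d} (h : W ∈ numBounded d)
    (h' : schA k ∘L W ∈ numBounded d) : schC k ∘L W ∈ numBounded d := by
  obtain ⟨C, hC⟩ := h
  obtain ⟨C', hC'⟩ := h'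
  refine ⟨C' + 2 * C, fun f => ?_⟩
  have h1 := norm_schC_le k (W f)
  have h2 := hC f
  have h3 := hC' f
  simp only [ContinuousLinearMap.comp_apply] at *
  linarith

theorem schA_comp_schA_mem_numBounded (k l : Fin d) : schA k ∘L schA l ∈ numBounded d :=
  ⟨1, fun f => by
    have := norm_schA_schA_le l k f
    have := norm_nonneg (toL2 d f)
    rw [ContinuousLinearMap.comp_apply]
    linarith⟩

theorem schA_comp_schC_mem_numBounded (k l : Fin d) : schA k ∘L schC l ∈ numBounded d := by
  have h : schA k ∘L schC l
      = schC l ∘L schA k + if k = l then (2 : ℂ) • ContinuousLinearMap.id ℂ (Schw d) else 0 := by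
    ext1 f
    rw [ContinuousLinearMap.comp_apply, schA_schC]
    split_ifs <;> rfl
  rw [h]
  refine add_mem (schC_comp_mem_numBounded (schA_mem_numBounded k)
    (schA_comp_schA_mem_numBounded _ _)) ?_
  split_ifs
  · exact Submodule.smul_mem _ _ id_mem_numBounded
  · exact zero_mem _

theorem comp_mem_numBounded_of_mem_ladderGen {W V : Schw d →L[ℂ] Schw d} (hW : W ∈ ladderGen d)
    (hV : V ∈ ladderGen d) : W ∘L V ∈ numBounded d := by
  rcases hW with (⟨k, rfl⟩ | ⟨k, rfl⟩) | rfl <;> rcases hV with (⟨l, rfl⟩ | ⟨l, rfl⟩) | rfl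
  · exact schA_comp_schA_mem_numBounded k l
  · exact schA_comp_schC_mem_numBounded k l
  · exact schA_mem_numBounded k
  · exact schC_comp_mem_numBounded (schA_mem_numBounded l) (schA_comp_schA_mem_numBounded _ _)
  · exact schC_comp_mem_numBounded (schC_mem_numBounded l) (schA_comp_schC_mem_numBounded _ _)
  · exact schC_mem_numBounded k
  · exact schA_mem_numBounded l
  · exact schC_mem_numBounded l
  · exact id_mem_numBounded

/-- By bilinearity only products of ladder operators matter; a creator on the left is replaced by an
annihilator, and annihilators are commuted to the right. -/
theorem comp_mem_numBounded {W V : Schw d →L[ℂ] Schw d} (hW : W ∈ firstOrder d)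
    (hV : V ∈ firstOrder d) : W ∘L V ∈ numBounded d := by
  induction hW using Submodule.span_induction with
  | zero => rw [ContinuousLinearMap.zero_comp]; exact zero_mem _
  | add _ _ _ _ h h' => rw [ContinuousLinearMap.add_comp]; exact add_mem h h'
  | smul c _ _ h => rw [ContinuousLinearMap.smul_comp]; exact Submodule.smul_mem _ _ h
  | mem W hW =>
    induction hV using Submodule.span_induction with
    | zero => rw [ContinuousLinearMap.comp_zero]; exact zero_mem _
    | add _ _ _ _ h h' => rw [ContinuousLinearMap.comp_add]; exact add_mem h h'
    | smul c _ _ h => rw [ContinuousLinearMap.comp_smul]; exact Submodule.smul_mem _ _ h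
    | mem V hV => exact comp_mem_numBounded_of_mem_ladderGen hW hV

theorem secondOrder_le_numBounded : secondOrder d ≤ numBounded d := by
  refine Submodule.span_le.2 ?_
  rintro _ ⟨W, hW, V, hV, rfl⟩
  exact comp_mem_numBounded hW hV

theorem comp_mem_secondOrder {W V : Schw d →L[ℂ] Schw d} (hW : W ∈ firstOrder d)
    (hV : V ∈ firstOrder d) : W ∘L V ∈ secondOrder d :=
  Submodule.subset_span ⟨W, hW, V, hV, rfl⟩

theorem schA_mem_firstOrder (k : Fin d) : schA k ∈ firstOrder d :=
  Submodule.subset_span (Or.inl (Or.inl ⟨k, rfl⟩))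

theorem schC_mem_firstOrder (k : Fin d) : schC k ∈ firstOrder d :=
  Submodule.subset_span (Or.inl (Or.inr ⟨k, rfl⟩))

theorem id_mem_firstOrder : ContinuousLinearMap.id ℂ (Schw d) ∈ firstOrder d :=
  Submodule.subset_span (Or.inr rfl)

theorem schX_mem_firstOrder (k : Fin d) : schX k ∈ firstOrder d := by
  rw [schX_eq]
  exact Submodule.smul_mem _ _ (add_mem (schA_mem_firstOrder k) (schC_mem_firstOrder k))

theorem schD_mem_firstOrder (k : Fin d) : schD k ∈ firstOrder d := by
  rw [schD_eq]
  exact Submodule.smul_mem _ _ (sub_mem (schA_mem_firstOrder k) (schC_mem_firstOrder k))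

/-! ### The expressions of the generator on Schwartz functions -/

/-- `α · x + β · ∇ + γ` on Schwartz functions. -/
def schL (α β : Fin d → ℂ) (γ : ℂ) : Schw d →L[ℂ] Schw d :=
  ∑ k : Fin d, α k • schX k + ∑ k : Fin d, β k • schD k + γ • ContinuousLinearMap.id ℂ (Schw d)

/-- `ᾱ · x - β̄ · ∇ + γ̄` on Schwartz functions. -/
def schLAdj (α β : Fin d → ℂ) (γ : ℂ) : Schw d →L[ℂ] Schw d :=
  ∑ k : Fin d, (starRingEnd ℂ (α k)) • schX k - ∑ k : Fin d, (starRingEnd ℂ (β k)) • schD k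
    + (starRingEnd ℂ γ) • ContinuousLinearMap.id ℂ (Schw d)

/-- The Hamiltonian on Schwartz functions. -/
def schH (d : ℕ) (μ : ℝ) : Schw d →L[ℂ] Schw d :=
  -((1 / 2 : ℂ) • ∑ k : Fin d, schD k ∘L schD k) + (1 / 2 : ℂ) • ∑ k : Fin d, schX k ∘L schX k
    - (Complex.I * (μ : ℂ)) • ∑ k : Fin d, (schX k ∘L schD k + schD k ∘L schX k)

/-- `-i H - ½ ∑ⱼ Lⱼ* Lⱼ` on Schwartz functions. -/
def schY {m : ℕ} (μ : ℝ) (α β : Fin m → Fin d → ℂ) (γ : Fin m → ℂ) : Schw d →L[ℂ] Schw d :=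
  -(Complex.I • schH d μ)
    - (1 / 2 : ℂ) • ∑ j : Fin m, schLAdj (α j) (β j) (γ j) ∘L schL (α j) (β j) (γ j)

theorem extends_lindblad (α β : Fin d → ℂ) (γ : ℂ) : Extends (lindblad α β γ) (schL α β γ) :=
  ((extends_sum _ fun k _ => (extends_coordMul k).smul _).add
    (extends_sum _ fun k _ => (extends_partialD k).smul _)).add (extends_id.smul _)

theorem extends_lindbladAdj (α β : Fin d → ℂ) (γ : ℂ) :
    Extends (lindbladAdj α β γ) (schLAdj α β γ) :=
  ((extends_sum _ fun k _ => (extends_coordMul k).smul _).sub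
    (extends_sum _ fun k _ => (extends_partialD k).smul _)).add (extends_id.smul _)

theorem extends_yExpr {m : ℕ} (μ : ℝ) (α β : Fin m → Fin d → ℂ) (γ : Fin m → ℂ) :
    Extends (yExpr μ α β γ) (schY μ α β γ) := by
  refine (Extends.smul ?_ _).neg.sub ((extends_sum _ fun j _ =>
    (extends_lindbladAdj _ _ _).comp (extends_lindblad _ _ _)).smul _)
  refine ((extends_laplace.smul _).neg.add (extends_normSqMul.smul _)).sub (Extends.smul ?_ _)
  exact extends_sum _ fun k _ => ((extends_coordMul k).comp (extends_partialD k)).add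
    ((extends_partialD k).comp (extends_coordMul k))

theorem schL_mem_firstOrder (α β : Fin d → ℂ) (γ : ℂ) : schL α β γ ∈ firstOrder d :=
  add_mem (add_mem (sum_mem fun k _ => Submodule.smul_mem _ _ (schX_mem_firstOrder k))
    (sum_mem fun k _ => Submodule.smul_mem _ _ (schD_mem_firstOrder k)))
    (Submodule.smul_mem _ _ id_mem_firstOrder)

theorem schLAdj_mem_firstOrder (α β : Fin d → ℂ) (γ : ℂ) : schLAdj α β γ ∈ firstOrder d :=
  add_mem (sub_mem (sum_mem fun k _ => Submodule.smul_mem _ _ (schX_mem_firstOrder k))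
    (sum_mem fun k _ => Submodule.smul_mem _ _ (schD_mem_firstOrder k)))
    (Submodule.smul_mem _ _ id_mem_firstOrder)

theorem schY_mem_secondOrder {m : ℕ} (μ : ℝ) (α β : Fin m → Fin d → ℂ) (γ : Fin m → ℂ) :
    schY μ α β γ ∈ secondOrder d := by
  refine sub_mem (neg_mem (Submodule.smul_mem _ _ ?_)) (Submodule.smul_mem _ _
    (sum_mem fun j _ => comp_mem_secondOrder (schLAdj_mem_firstOrder _ _ _)
      (schL_mem_firstOrder _ _ _)))
  refine sub_mem (add_mem (neg_mem (Submodule.smul_mem _ _ ?_)) (Submodule.smul_mem _ _ ?_))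
    (Submodule.smul_mem _ _ ?_)
  · exact sum_mem fun k _ => comp_mem_secondOrder (schD_mem_firstOrder k) (schD_mem_firstOrder k)
  · exact sum_mem fun k _ => comp_mem_secondOrder (schX_mem_firstOrder k) (schX_mem_firstOrder k)
  · exact sum_mem fun k _ => add_mem
      (comp_mem_secondOrder (schX_mem_firstOrder k) (schD_mem_firstOrder k))
      (comp_mem_secondOrder (schD_mem_firstOrder k) (schX_mem_firstOrder k))

theorem IsFormalAdj.congr_right {W W' W'' : Schw d →L[ℂ] Schw d} (h : IsFormalAdj W W')
    (e : W' = W'') : IsFormalAdj W W'' := e ▸ h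

theorem isFormalAdj_schL (α β : Fin d → ℂ) (γ : ℂ) :
    IsFormalAdj (schL α β γ) (schLAdj α β γ) := by
  refine (((isFormalAdj_sum _ fun k _ => (isFormalAdj_schX k).smul _).add
    (isFormalAdj_sum _ fun k _ => (isFormalAdj_schD k).smul _)).add
      (isFormalAdj_id.smul _)).congr_right ?_
  simp only [schLAdj, smul_neg, Finset.sum_neg_distrib, sub_eq_add_neg]

/-- The anticommutator of `x` and `∇` is formally skew, and its coefficient `iμ` is purely
imaginary. -/
theorem isFormalAdj_schH (μ : ℝ) : IsFormalAdj (schH d μ) (schH d μ) := by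
  refine ((((isFormalAdj_sum _ fun k _ =>
    (isFormalAdj_schD k).comp (isFormalAdj_schD k)).smul _).neg.add
    ((isFormalAdj_sum _ fun k _ => (isFormalAdj_schX k).comp (isFormalAdj_schX k)).smul _)).sub
    ((isFormalAdj_sum _ fun k _ => ((isFormalAdj_schX k).comp (isFormalAdj_schD k)).add
      ((isFormalAdj_schD k).comp (isFormalAdj_schX k))).smul _)).congr_right ?_
  have h1 : starRingEnd ℂ (1 / 2 : ℂ) = 1 / 2 := by rw [map_div₀, map_one, map_ofNat]
  have h2 : starRingEnd ℂ (Complex.I * (μ : ℂ)) = -(Complex.I * μ) := by simp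
  have h3 : ∀ k : Fin d, ((-schD k) ∘L schX k + schX k ∘L (-schD k) : Schw d →L[ℂ] Schw d)
      = -(schX k ∘L schD k + schD k ∘L schX k) := by
    intro k
    rw [ContinuousLinearMap.neg_comp, ContinuousLinearMap.comp_neg]
    abel
  have h4 : ∀ k : Fin d, ((-schD k) ∘L (-schD k) : Schw d →L[ℂ] Schw d) = schD k ∘L schD k := by
    intro k
    rw [ContinuousLinearMap.neg_comp, ContinuousLinearMap.comp_neg, neg_neg]
  simp only [h1, h2, h3, h4, Finset.sum_neg_distrib, schH, smul_neg, neg_smul, neg_neg]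

/-- The formal adjoint of `Y` is `iH - ½ ∑ Lⱼ* Lⱼ`; adding `Y` cancels the Hamiltonian part and
leaves `-∑ Lⱼ* Lⱼ`. -/
theorem inner_schY_add {m : ℕ} (μ : ℝ) (α β : Fin m → Fin d → ℂ) (γ : Fin m → ℂ) (f g : Schw d) :
    inner ℂ (toL2 d (schY μ α β γ f)) (toL2 d g) + inner ℂ (toL2 d f) (toL2 d (schY μ α β γ g))
      + ∑ j, inner ℂ (toL2 d (schL (α j) (β j) (γ j) f)) (toL2 d (schL (α j) (β j) (γ j) g))
      = 0 := by
  have h1 : IsFormalAdj (schY μ α β γ) (Complex.I • schH d μ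
      - (1 / 2 : ℂ) • ∑ j : Fin m, schLAdj (α j) (β j) (γ j) ∘L schL (α j) (β j) (γ j)) := by
    refine (((isFormalAdj_schH μ).smul _).neg.sub ((isFormalAdj_sum _ fun j _ =>
      (isFormalAdj_schL (α j) (β j) (γ j)).symm.comp
        (isFormalAdj_schL (α j) (β j) (γ j))).smul _)).congr_right ?_
    rw [map_div₀, map_one, map_ofNat, Complex.conj_I, neg_smul, neg_neg]
  rw [h1 f g, ← inner_add_right, ← map_add]
  have h2 : ∀ j, inner ℂ (toL2 d (schL (α j) (β j) (γ j) f))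
      (toL2 d (schL (α j) (β j) (γ j) g)) = inner ℂ (toL2 d f)
      (toL2 d ((schLAdj (α j) (β j) (γ j) ∘L schL (α j) (β j) (γ j)) g)) :=
    fun j => isFormalAdj_schL (α j) (β j) (γ j) f _
  simp only [h2]
  rw [← inner_sum, ← inner_add_right, ← map_sum, ← map_add, ← sum_apply, ← add_apply, ← add_apply]
  have h3 : ∀ S : Schw d →L[ℂ] Schw d, (Complex.I • schH d μ - (1 / 2 : ℂ) • S
      + (-(Complex.I • schH d μ) - (1 / 2 : ℂ) • S) + S) = 0 := by
    intro S; module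
  rw [schY, h3]
  simp

/-! ### The Gaussian -/

theorem pow_mul_exp_neg_half_sq_le (q : ℕ) {r : ℝ} (hr : 0 ≤ r) :
    (1 + r) ^ q * Real.exp (-(1 / 2) * r ^ 2) ≤ q.factorial * Real.exp 2 := by
  have h1 : (1 + r) ^ q ≤ q.factorial * Real.exp (1 + r) := by
    have := Real.pow_div_factorial_le_exp (1 + r) (by positivity) q
    rwa [div_le_iff₀ (by positivity), mul_comm] at this
  calc (1 + r) ^ q * Real.exp (-(1 / 2) * r ^ 2)
      ≤ q.factorial * Real.exp (1 + r) * Real.exp (-(1 / 2) * r ^ 2) := by gcongr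
    _ = q.factorial * Real.exp (1 + r + -(1 / 2) * r ^ 2) := by rw [mul_assoc, ← Real.exp_add]
    _ ≤ q.factorial * Real.exp 2 := by
      gcongr
      nlinarith [sq_nonneg (r - 1)]

theorem norm_iteratedFDeriv_gaussian_le (d n : ℕ) : ∃ k : ℕ, ∃ C : ℝ, 0 ≤ C ∧ ∀ x : Space d,
    ‖iteratedFDeriv ℝ n (fun x : Space d => Real.exp (-(1 / 2) * ‖x‖ ^ 2)) x‖
      ≤ C * (1 + ‖x‖) ^ k * Real.exp (-(1 / 2) * ‖x‖ ^ 2) := by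
  obtain ⟨k, C, hC, hb⟩ :=
    (Function.hasTemperateGrowth_norm_sq (H := Space d)).norm_iteratedFDeriv_le_uniform n
  -- The Faà di Bruno estimate wants the `i`-th derivative of `|x|²` below `Dⁱ`. Using `1 + C` in
  -- place of `C` ensures `D = (1 + C)(1 + |x|)^k ≥ 1`, so that `D ≤ Dⁱ` for `i ≥ 1`.
  refine ⟨k * n, n.factorial * (1 + C) ^ n, by positivity, fun x => ?_⟩
  have h1 : ∀ i ≤ n, ‖iteratedFDeriv ℝ i (fun s : ℝ => Real.exp (-(1 / 2) * s)) (‖x‖ ^ 2)‖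
      ≤ Real.exp (-(1 / 2) * ‖x‖ ^ 2) := by
    intro i _
    rw [norm_iteratedFDeriv_eq_norm_iteratedDeriv, iteratedDeriv_exp_const_mul, norm_mul, norm_pow,
      Real.norm_of_nonneg (Real.exp_pos _).le]
    refine mul_le_of_le_one_left (Real.exp_pos _).le (pow_le_one₀ (norm_nonneg _) ?_)
    norm_num
  have h2 : ∀ i, 1 ≤ i → i ≤ n → ‖iteratedFDeriv ℝ i (fun x : Space d => ‖x‖ ^ 2) x‖
      ≤ ((1 + C) * (1 + ‖x‖) ^ k) ^ i := by
    intro i hi hin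
    have h3 : 1 ≤ (1 + ‖x‖) ^ k := one_le_pow₀ (by linarith [norm_nonneg x])
    have h4 : 1 ≤ (1 + C) * (1 + ‖x‖) ^ k := one_le_mul_of_one_le_of_one_le (by linarith) h3
    calc _ ≤ C * (1 + ‖x‖) ^ k := hb i hin x
      _ ≤ (1 + C) * (1 + ‖x‖) ^ k := by gcongr; linarith
      _ ≤ _ := le_self_pow₀ h4 (by omega)
  have h5 := norm_iteratedFDeriv_comp_le (𝕜 := ℝ) (g := fun s : ℝ => Real.exp (-(1 / 2) * s))
    (f := fun x : Space d => ‖x‖ ^ 2) (n := n) (N := n) (by fun_prop)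
    (contDiff_norm_sq ℝ) le_rfl x h1 h2
  refine h5.trans_eq ?_
  rw [mul_pow, ← pow_mul]
  ring

/-- The real Gaussian `exp (-|x|² / 2)` as a Schwartz function. -/
def realGaussian (d : ℕ) : 𝓢(Space d, ℝ) where
  toFun x := Real.exp (-(1 / 2) * ‖x‖ ^ 2)
  smooth' := Real.contDiff_exp.comp (contDiff_const.mul (contDiff_norm_sq ℝ))
  decay' p n := by
    obtain ⟨k, C, hC, h⟩ := norm_iteratedFDeriv_gaussian_le d n
    refine ⟨C * ((p + k).factorial * Real.exp 2), fun x => ?_⟩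
    calc ‖x‖ ^ p * _ ≤ (1 + ‖x‖) ^ p * (C * (1 + ‖x‖) ^ k * Real.exp (-(1 / 2) * ‖x‖ ^ 2)) := by
          gcongr
          · linarith
          · exact h x
      _ = C * ((1 + ‖x‖) ^ (p + k) * Real.exp (-(1 / 2) * ‖x‖ ^ 2)) := by ring
      _ ≤ _ := mul_le_mul_of_nonneg_left (pow_mul_exp_neg_half_sq_le _ (norm_nonneg x)) hC

/-- The Gaussian `exp (-|x|² / 2)` as a complex-valued Schwartz function. -/
def gaussian (d : ℕ) : Schw d := SchwartzMap.postcompCLM Complex.ofRealCLM (realGaussian d)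

theorem gaussian_apply (x : Space d) :
    gaussian d x = ((Real.exp (-(1 / 2) * ‖x‖ ^ 2) : ℝ) : ℂ) := rfl

theorem schA_gaussian (k : Fin d) : schA k (gaussian d) = 0 := by
  ext x
  change schX k (gaussian d) x + schD k (gaussian d) x = 0
  rw [schX_apply, schD_apply]
  have h1 : HasFDerivAt (fun x : Space d => Real.exp (-(1 / 2) * ‖x‖ ^ 2)) _ x :=
    (((hasStrictFDerivAt_norm_sq x).hasFDerivAt).const_mul (-(1 / 2) : ℝ)).exp
  have h2 : HasFDerivAt (gaussian d : Space d → ℂ) _ x :=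
    Complex.ofRealCLM.hasFDerivAt.comp x h1
  rw [h2.fderiv, gaussian_apply]
  simp [EuclideanSpace.inner_single_right]
  ring

/-! ### The filtration by Hermite functions -/

/-- Products of polynomials of degree at most `n` with the Gaussian. -/
def hermiteFilt (d : ℕ) : ℕ → Submodule ℂ (Schw d)
  | 0 => Submodule.span ℂ {gaussian d}
  | n + 1 => hermiteFilt d n ⊔ ⨆ k : Fin d, (hermiteFilt d n).map (schX k).toLinearMap

theorem gaussian_mem_hermiteFilt : gaussian d ∈ hermiteFilt d 0 :=
  Submodule.mem_span_singleton_self _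

theorem hermiteFilt_mono : Monotone (hermiteFilt d) :=
  monotone_nat_of_le_succ fun _ => le_sup_left

theorem schX_mem_hermiteFilt (k : Fin d) {n : ℕ} {f : Schw d} (hf : f ∈ hermiteFilt d n) :
    schX k f ∈ hermiteFilt d (n + 1) :=
  Submodule.mem_sup_right (Submodule.mem_iSup_of_mem k ⟨f, hf, rfl⟩)

theorem hermiteFilt_succ_le {n : ℕ} {S : Submodule ℂ (Schw d)} (h : hermiteFilt d n ≤ S)
    (h' : ∀ k, ∀ f ∈ hermiteFilt d n, schX k f ∈ S) : hermiteFilt d (n + 1) ≤ S := by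
  refine sup_le h (iSup_le fun k => ?_)
  rintro _ ⟨f, hf, rfl⟩
  exact h' k f hf

theorem schA_eq_zero (k : Fin d) {f : Schw d} (hf : f ∈ hermiteFilt d 0) : schA k f = 0 := by
  obtain ⟨c, rfl⟩ := Submodule.mem_span_singleton.1 hf
  rw [map_smul, schA_gaussian, smul_zero]

theorem schA_schX (k l : Fin d) (f : Schw d) :
    schA k (schX l f) = schX l (schA k f) + if k = l then f else 0 := by
  simp only [schA_apply, map_add, schD_schX, schX_comm k l]
  abel

/-- Annihilators kill the Gaussian and act as derivations `2`-free on its polynomial factor, `Aₖ(xₗ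
f) = xₗ Aₖ f + δₖₗ f`, so they lower the degree. -/
theorem schA_mem_hermiteFilt (k : Fin d) {n : ℕ} {f : Schw d} (hf : f ∈ hermiteFilt d (n + 1)) :
    schA k f ∈ hermiteFilt d n := by
  suffices h : hermiteFilt d (n + 1) ≤ (hermiteFilt d n).comap (schA k).toLinearMap from h hf
  clear hf f
  induction n with
  | zero =>
    refine hermiteFilt_succ_le (fun f hf => ?_) fun l f hf => ?_
    · change schA k f ∈ hermiteFilt d 0
      rw [schA_eq_zero k hf]
      exact zero_mem _
    · change schA k (schX l f) ∈ hermiteFilt d 0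
      rw [schA_schX, schA_eq_zero k hf, map_zero, zero_add]
      split_ifs
      exacts [hf, zero_mem _]
  | succ n ih =>
    refine hermiteFilt_succ_le (fun f hf => hermiteFilt_mono n.le_succ (ih hf)) fun l f hf => ?_
    change schA k (schX l f) ∈ hermiteFilt d (n + 1)
    rw [schA_schX]
    refine add_mem (schX_mem_hermiteFilt l (ih hf)) ?_
    split_ifs
    exacts [hf, zero_mem _]

theorem schA_mem_hermiteFilt_self (k : Fin d) {n : ℕ} {f : Schw d} (hf : f ∈ hermiteFilt d n) :
    schA k f ∈ hermiteFilt d n :=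
  schA_mem_hermiteFilt k (hermiteFilt_mono n.le_succ hf)

theorem schC_mem_hermiteFilt (k : Fin d) {n : ℕ} {f : Schw d} (hf : f ∈ hermiteFilt d n) :
    schC k f ∈ hermiteFilt d (n + 1) := by
  have h : schC k f = (2 : ℂ) • schX k f - schA k f := by
    rw [schC_apply, schA_apply]; module
  rw [h]
  exact sub_mem (Submodule.smul_mem _ _ (schX_mem_hermiteFilt k hf))
    (hermiteFilt_mono n.le_succ (schA_mem_hermiteFilt_self k hf))

theorem schNum_mem_hermiteFilt {n : ℕ} {f : Schw d} (hf : f ∈ hermiteFilt d n) :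
    schNum d f ∈ hermiteFilt d n := by
  rw [schNum_apply]
  refine sum_mem fun k _ => ?_
  cases n with
  | zero => rw [schA_eq_zero k hf, map_zero]; exact zero_mem _
  | succ n => exact schC_mem_hermiteFilt k (schA_mem_hermiteFilt k hf)

theorem schOsc_mem_hermiteFilt {n : ℕ} {f : Schw d} (hf : f ∈ hermiteFilt d n) :
    schOsc d f ∈ hermiteFilt d n := by
  rw [schOsc_apply]
  exact add_mem (schNum_mem_hermiteFilt hf) (Submodule.smul_mem _ _ hf)

theorem firstOrder_mem_hermiteFilt {W : Schw d →L[ℂ] Schw d} (hW : W ∈ firstOrder d) {n : ℕ}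
    {f : Schw d} (hf : f ∈ hermiteFilt d n) : W f ∈ hermiteFilt d (n + 1) := by
  induction hW using Submodule.span_induction with
  | zero => exact zero_mem _
  | add _ _ _ _ h h' => exact add_mem h h'
  | smul c _ _ h => exact Submodule.smul_mem _ _ h
  | mem W hW =>
    rcases hW with (⟨k, rfl⟩ | ⟨k, rfl⟩) | rfl
    · exact hermiteFilt_mono n.le_succ (schA_mem_hermiteFilt_self k hf)
    · exact schC_mem_hermiteFilt k hf
    · exact hermiteFilt_mono n.le_succ hf

theorem secondOrder_mem_hermiteFilt {W : Schw d →L[ℂ] Schw d} (hW : W ∈ secondOrder d) {n : ℕ}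
    {f : Schw d} (hf : f ∈ hermiteFilt d n) : W f ∈ hermiteFilt d (n + 2) := by
  induction hW using Submodule.span_induction with
  | zero => exact zero_mem _
  | add _ _ _ _ h h' => exact add_mem h h'
  | smul c _ _ h => exact Submodule.smul_mem _ _ h
  | mem U hU =>
    obtain ⟨W, hW, V, hV, rfl⟩ := hU
    exact firstOrder_mem_hermiteFilt hW (firstOrder_mem_hermiteFilt hV hf)

theorem sum_norm_schA_sq_le (f : Schw d) :
    ∑ k, ‖toL2 d (schA k f)‖ ^ 2 ≤ ‖toL2 d f‖ * ‖toL2 d (schNum d f)‖ := by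
  have h := congrArg norm (sum_norm_schA_sq f)
  rw [Complex.norm_real, Real.norm_of_nonneg
    (Finset.sum_nonneg fun _ _ => sq_nonneg _)] at h
  rw [h]
  exact norm_inner_le_norm _ _

/-- This replaces diagonalizing `N`. As `Aₖ f` has lower degree, induction gives `∑ₗ ‖Aₗ Aₖ f‖² ≤ 2n
‖Aₖ f‖²`; with `norm_schNum_sq` this yields `‖N f‖² ≤ (2n + 2) ⟨f, N f⟩`, and Cauchy-Schwarz lets
one factor `‖N f‖` cancel. -/
theorem norm_schNum_le {n : ℕ} {f : Schw d} (hf : f ∈ hermiteFilt d n) :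
    ‖toL2 d (schNum d f)‖ ≤ 2 * n * ‖toL2 d f‖ := by
  induction n generalizing f with
  | zero =>
    have h : schNum d f = 0 := by
      rw [schNum_apply]
      exact Finset.sum_eq_zero fun k _ => by rw [schA_eq_zero k hf, map_zero]
    simp [h]
  | succ n ih =>
    have h1 : ∀ k, ∑ l, ‖toL2 d (schA l (schA k f))‖ ^ 2 ≤ 2 * n * ‖toL2 d (schA k f)‖ ^ 2 := by
      intro k
      refine (sum_norm_schA_sq_le _).trans ?_
      have := mul_le_mul_of_nonneg_left (ih (schA_mem_hermiteFilt k hf))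
        (norm_nonneg (toL2 d (schA k f)))
      linarith
    have h2 := Finset.sum_le_sum fun k (_ : k ∈ Finset.univ) => h1 k
    rw [← Finset.mul_sum] at h2
    have h3 := norm_schNum_sq f
    have h4 := mul_le_mul_of_nonneg_left (sum_norm_schA_sq_le f)
      (by positivity : (0 : ℝ) ≤ 2 * n + 2)
    have h5 : ‖toL2 d (schNum d f)‖ * ‖toL2 d (schNum d f)‖
        ≤ (2 * (n + 1 : ℕ) * ‖toL2 d f‖) * ‖toL2 d (schNum d f)‖ := by
      push_cast
      linarith
    rcases (norm_nonneg (toL2 d (schNum d f))).eq_or_lt with h0 | h0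
    · rw [← h0]; positivity
    · exact le_of_mul_le_mul_right h5 h0

/-- The filtration of `L²` by Hermite functions. -/
def hermiteL2 (d n : ℕ) : Submodule ℂ (L2 d) := (hermiteFilt d n).map (toL2 d).toLinearMap

theorem hermiteL2_mono : Monotone (hermiteL2 d) :=
  fun _ _ h => Submodule.map_mono (hermiteFilt_mono h)

instance hermiteFilt_finiteDimensional (n : ℕ) : FiniteDimensional ℂ (hermiteFilt d n) := by
  induction n with
  | zero =>
    change FiniteDimensional ℂ (Submodule.span ℂ {gaussian d})
    infer_instance
  | succ n ih =>
    change FiniteDimensional ℂ (hermiteFilt d n ⊔ ⨆ k : Fin d,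
      (hermiteFilt d n).map (schX k).toLinearMap : Submodule ℂ (Schw d))
    infer_instance

instance hermiteL2_finiteDimensional (n : ℕ) : FiniteDimensional ℂ (hermiteL2 d n) := by
  change FiniteDimensional ℂ ((hermiteFilt d n).map (toL2 d).toLinearMap)
  infer_instance

/-! ### Completeness of the Hermite functions -/

theorem memLp_exp_mul_norm_mul_gaussian (c : ℝ) :
    MemLp (fun x : Space d => Real.exp (c * ‖x‖) * ‖gaussian d x‖) 2 := by
  have hcont : Continuous fun x : Space d => Real.exp (c * ‖x‖) * ‖gaussian d x‖ :=
    (Real.continuous_exp.comp (continuous_const.mul continuous_norm)).mul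
      (gaussian d).continuous.norm
  rw [memLp_two_iff_integrable_sq hcont.aestronglyMeasurable]
  refine (((realGaussian d).integrable (μ := volume)).const_mul
    (Real.exp (2 * c ^ 2))).mono' (hcont.pow 2).aestronglyMeasurable
    (Eventually.of_forall fun x => ?_)
  rw [Real.norm_of_nonneg (sq_nonneg _), gaussian_apply, Complex.norm_real,
    Real.norm_of_nonneg (Real.exp_pos _).le, ← Real.exp_add, ← Real.exp_nat_mul]
  change _ ≤ Real.exp (2 * c ^ 2) * Real.exp (-(1 / 2) * ‖x‖ ^ 2)
  rw [← Real.exp_add]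
  refine Real.exp_le_exp.2 ?_
  push_cast
  -- Completing the square: `2c|x| - |x|² ≤ 2c² - |x|²/2`.
  nlinarith [sq_nonneg (‖x‖ - 2 * c)]

theorem integrable_exp_mul_norm_mul_gaussian (c : ℝ) (g : L2 d) :
    Integrable fun x : Space d => Real.exp (c * ‖x‖) * ‖gaussian d x * g x‖ := by
  have h := (memLp_exp_mul_norm_mul_gaussian (d := d) c).integrable_mul (Lp.memLp g).norm
  refine h.congr (Eventually.of_forall fun x => ?_)
  dsimp only
  rw [Pi.mul_apply, norm_mul, mul_assoc]

theorem integrable_gaussian_mul (g : L2 d) :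
    Integrable fun x : Space d => gaussian d x * g x := by
  have h := integrable_exp_mul_norm_mul_gaussian 0 g
  simp only [zero_mul, Real.exp_zero, one_mul] at h
  exact (integrable_norm_iff ((gaussian d).continuous.aestronglyMeasurable.mul
    (Lp.aestronglyMeasurable g))).1 h

theorem exists_inner_pow_mul_gaussian (t : Space d) (n : ℕ) : ∃ f ∈ hermiteFilt d n,
    ∀ x, f x = (((inner ℝ x t : ℝ) ^ n : ℝ) : ℂ) * gaussian d x := by
  induction n with
  | zero => exact ⟨gaussian d, gaussian_mem_hermiteFilt, fun x => by simp⟩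
  | succ n ih =>
    obtain ⟨f, hf, hfx⟩ := ih
    refine ⟨∑ k, (t k : ℂ) • schX k f,
      sum_mem fun k _ => Submodule.smul_mem _ _ (schX_mem_hermiteFilt k hf), fun x => ?_⟩
    rw [sum_apply]
    have h : ∀ k, ((t k : ℂ) • schX k f) x = ((t k * x k : ℝ) : ℂ) * f x := by
      intro k
      rw [smul_apply, schX_apply, smul_eq_mul]
      push_cast
      ring
    simp only [h]
    rw [← Finset.sum_mul, ← Complex.ofReal_sum, hfx, pow_succ', Complex.ofReal_mul, mul_assoc]
    simp [PiLp.inner_apply]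

/-- Expanding the character in its power series, each term pairs `g` with a power of `x · w` times
the Gaussian, hence vanishes. Dominated convergence applies since `e^{2π|w||x|}` times the Gaussian
is in `L²`. -/
theorem fourier_gaussian_mul_eq_zero {g : L2 d}
    (hg : ∀ n, ∀ f ∈ hermiteFilt d n, inner ℂ (toL2 d f) g = 0) (w : Space d) :
    FourierTransform.fourier (fun x : Space d => gaussian d x * g x) w = 0 := by
  rw [Real.fourier_eq']
  set F : Space d → ℂ := fun x => gaussian d x * g x with hF
  let z : ℂ := ((-2 * Real.pi : ℝ) : ℂ) * Complex.I
  have hzn : ‖z‖ = 2 * Real.pi := by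
    simp [z, abs_of_pos Real.pi_pos]
  have hmeas : AEStronglyMeasurable F := (integrable_gaussian_mul g).aestronglyMeasurable
  have hzero : ∀ n : ℕ, ∫ x, ((z * (inner ℝ x w : ℝ)) ^ n / (n.factorial : ℂ)) * F x = 0 := by
    intro n
    obtain ⟨f, hf, hfx⟩ := exists_inner_pow_mul_gaussian w n
    have h1 := hg n f hf
    rw [L2.inner_def] at h1
    have h2 : ∫ x, (((inner ℝ x w : ℝ) ^ n : ℝ) : ℂ) * F x = 0 := by
      rw [← h1]
      refine integral_congr_ae ?_
      filter_upwards [f.coeFn_toLp 2 volume] with x hx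
      have hx' : (toL2 d f : Space d → ℂ) x = f x := hx
      rw [RCLike.inner_apply, hx', hfx, map_mul, Complex.conj_ofReal, gaussian_apply,
        Complex.conj_ofReal, hF]
      dsimp only
      rw [gaussian_apply]
      ring
    have h3 : ∀ x, ((z * (inner ℝ x w : ℝ)) ^ n / (n.factorial : ℂ)) * F x
        = (z ^ n / (n.factorial : ℂ)) * ((((inner ℝ x w : ℝ) ^ n : ℝ) : ℂ) * F x) := by
      intro x
      rw [mul_pow]
      push_cast
      ring
    simp only [h3]
    rw [integral_const_mul, h2, mul_zero]
  have hsum := hasSum_integral_of_dominated_convergence (μ := (volume : Measure (Space d)))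
    (F := fun (n : ℕ) x => ((z * (inner ℝ x w : ℝ)) ^ n / (n.factorial : ℂ)) * F x)
    (f := fun x => Complex.exp (z * (inner ℝ x w : ℝ)) * F x)
    (fun n x => ((2 * Real.pi * ‖w‖ * ‖x‖) ^ n / n.factorial) * ‖F x‖) ?_ ?_ ?_ ?_ ?_
  · simp only [hzero] at hsum
    rw [← hsum.unique hasSum_zero]
    refine integral_congr_ae (Eventually.of_forall fun x => ?_)
    dsimp only
    rw [smul_eq_mul]
    congr 2
    simp only [z]
    push_cast
    ring
  · intro n
    refine Continuous.aestronglyMeasurable ?_ |>.mul hmeas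
    fun_prop
  · intro n
    refine Eventually.of_forall fun x => ?_
    rw [norm_mul, norm_div, norm_pow, norm_mul, hzn, Complex.norm_real, Complex.norm_natCast]
    have hb : 2 * Real.pi * ‖(inner ℝ x w : ℝ)‖ ≤ 2 * Real.pi * ‖w‖ * ‖x‖ := by
      have := mul_le_mul_of_nonneg_left (norm_inner_le_norm (𝕜 := ℝ) x w) Real.two_pi_pos.le
      exact this.trans_eq (by ring)
    gcongr
  · exact Eventually.of_forall fun x => (Real.summable_pow_div_factorial _).mul_right _
  · refine (integrable_exp_mul_norm_mul_gaussian (2 * Real.pi * ‖w‖) g).congr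
      (Eventually.of_forall fun x => ?_)
    dsimp only
    rw [tsum_mul_right, Real.exp_eq_exp_ℝ, NormedSpace.exp_eq_tsum_div]
  · refine Eventually.of_forall fun x => HasSum.mul_right _ ?_
    rw [Complex.exp_eq_exp_ℂ]
    exact NormedSpace.expSeries_div_hasSum_exp _

/-- The Gaussian times `g` is integrable with zero Fourier transform. Moving the Fourier transform
from test functions onto it shows that it vanishes almost everywhere, and the Gaussian has no zeros.
-/
theorem eq_zero_of_forall_inner_hermite {g : L2 d}
    (hg : ∀ n, ∀ f ∈ hermiteFilt d n, inner ℂ (toL2 d f) g = 0) : g = 0 := by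
  set F : Space d → ℂ := fun x => gaussian d x * g x with hF
  have hint : Integrable F := integrable_gaussian_mul g
  have h1 : ∀ φ : Schw d, ∫ x, φ x • F x = 0 := by
    intro φ
    obtain ⟨ψ, rfl⟩ : ∃ ψ : Schw d, FourierTransform.fourier ψ = φ :=
      ⟨_, FourierTransform.fourier_fourierInv_eq φ⟩
    have h2 := VectorFourier.integral_fourierIntegral_smul_eq_flip (μ := volume) (ν := volume)
      (L := innerₗ (Space d)) Real.continuous_fourierChar continuous_inner
      (ψ.integrable (μ := volume)) hint
    rw [flip_innerₗ] at h2
    refine h2.trans ?_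
    have h3 : ∀ w,
        VectorFourier.fourierIntegral Real.fourierChar volume (innerₗ (Space d)) F w = 0 :=
      fun w => fourier_gaussian_mul_eq_zero hg w
    simp [h3]
  have h2 := ae_eq_zero_of_integral_contDiff_smul_eq_zero (μ := volume) hint.locallyIntegrable
    fun u hu hu' => by
      have hs : HasCompactSupport fun x => (u x : ℂ) := hu'.comp_left Complex.ofReal_zero
      exact h1 (hs.toSchwartzMap (Complex.ofRealCLM.contDiff.comp hu))
  refine Lp.eq_zero_iff_ae_eq_zero.2 ?_
  filter_upwards [h2] with x hx
  rw [hF] at hx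
  refine (mul_eq_zero.1 hx).resolve_left ?_
  rw [gaussian_apply]
  exact Complex.ofReal_ne_zero.2 (Real.exp_pos _).ne'

theorem hermiteL2_topologicalClosure (d : ℕ) :
    (⨆ n, hermiteL2 d n).topologicalClosure = ⊤ := by
  rw [Submodule.topologicalClosure_eq_top_iff, Submodule.eq_bot_iff]
  intro g hg
  refine eq_zero_of_forall_inner_hermite fun n f hf => ?_
  exact (Submodule.mem_orthogonal _ _).1 hg _ (Submodule.mem_iSup_of_mem n ⟨f, hf, rfl⟩)

/-- The orthogonal projections onto the Hermite filtration converge strongly to the identity. -/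
theorem tendsto_hermite_starProjection (g : L2 d) :
    Tendsto (fun n => (hermiteL2 d n).starProjection g) atTop (𝓝 g) :=
  Submodule.starProjection_tendsto_self _ hermiteL2_mono g (hermiteL2_topologicalClosure d).ge

theorem exists_hermite_eq_starProjection (n : ℕ) (g : L2 d) :
    ∃ f ∈ hermiteFilt d n, toL2 d f = (hermiteL2 d n).starProjection g :=
  (Submodule.starProjection_apply_mem _ g : (hermiteL2 d n).starProjection g ∈ hermiteL2 d n)

theorem inner_starProjection_of_mem {n : ℕ} {f : Schw d} (hf : f ∈ hermiteFilt d n) (g : L2 d) :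
    inner ℂ (toL2 d f) ((hermiteL2 d n).starProjection g) = inner ℂ (toL2 d f) g := by
  have h := Submodule.starProjection_inner_eq_zero (K := hermiteL2 d n) g (toL2 d f) ⟨f, hf, rfl⟩
  rw [← inner_conj_symm, map_eq_zero, inner_sub_right, sub_eq_zero] at h
  exact h.symm

end QuasiFree

/-! ### The Carleman argument for density of the range -/

/-- If `s m > 0`, monotonicity bounds the tail of the harmonic series by a multiple of the two-step
increments, whose sum telescopes and is bounded. -/
theorem nonpos_of_carleman {s : ℕ → ℝ} (hs : Monotone s) {B : ℝ} (hB : ∀ n, s n ≤ B) {l K : ℝ}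
    (hl : 0 < l) (h : ∀ n, l * s (n + 1) ≤ K * (n + 1) * (s (n + 2) - s n)) (m : ℕ) :
    s m ≤ 0 := by
  by_contra! hm
  have hd : ∀ n, 0 ≤ s (n + 2) - s n := fun n => sub_nonneg.2 (hs (by omega))
  have hsum : Summable fun n => s (n + 2) - s n := by
    refine summable_of_sum_range_le (c := 2 * B - s 0 - s 1) hd fun N => ?_
    have : ∑ n ∈ Finset.range N, (s (n + 2) - s n) = s (N + 1) + s N - s 0 - s 1 := by
      induction N with
      | zero => simp
      | succ N ih => rw [Finset.sum_range_succ, ih]; ring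
    rw [this]
    linarith [hB N, hB (N + 1)]
  have hsum' : Summable fun n : ℕ => (1 : ℝ) / ((n + m + 1 : ℕ) : ℝ) := by
    refine Summable.of_nonneg_of_le (fun n => by positivity) (fun n => ?_)
      (((summable_nat_add_iff m).2 hsum).mul_left (K / (l * s m)))
    have h1 := h (n + m)
    have h2 : l * s m ≤ l * s (n + m + 1) := mul_le_mul_of_nonneg_left (hs (by omega)) hl.le
    push_cast at h1 ⊢
    rw [div_mul_eq_mul_div, div_le_div_iff₀ (by positivity) (by positivity)]
    linarith
  have h3 := (summable_nat_add_iff (f := fun n : ℕ => (1 : ℝ) / (n : ℝ)) (m + 1)).1 hsum'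
  exact Real.not_summable_one_div_natCast h3

namespace QuasiFree

variable {d : ℕ}

theorem norm_sub_starProjection_sq {M N : ℕ} (hMN : M ≤ N) (g : L2 d) :
    ‖(hermiteL2 d N).starProjection g - (hermiteL2 d M).starProjection g‖ ^ 2
      = ‖(hermiteL2 d N).starProjection g‖ ^ 2 - ‖(hermiteL2 d M).starProjection g‖ ^ 2 := by
  obtain ⟨v, hv, hvg⟩ := exists_hermite_eq_starProjection M g
  have h1 : inner ℂ ((hermiteL2 d M).starProjection g) ((hermiteL2 d N).starProjection g)
      = ((‖(hermiteL2 d M).starProjection g‖ ^ 2 : ℝ) : ℂ) := by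
    rw [← inner_self_toL2, ← hvg, inner_starProjection_of_mem (hermiteFilt_mono hMN hv), hvg,
      ← hvg, ← inner_starProjection_of_mem hv, hvg]
  rw [norm_sub_sq (𝕜 := ℂ), ← inner_conj_symm, h1, Complex.conj_ofReal]
  rw [RCLike.re_eq_complex_re, Complex.ofReal_re]
  ring

/-- A Carleman type criterion: if `W` is dissipative of second order, then the range of `l - W` on
Schwartz functions is dense. -/
theorem eq_zero_of_forall_inner_secondOrder {W : Schw d →L[ℂ] Schw d} (hW : W ∈ secondOrder d)
    (hdiss : ∀ f, (inner ℂ (toL2 d f) (toL2 d (W f))).re ≤ 0) {l : ℝ} (hl : 0 < l) {g : L2 d}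
    (hg : ∀ f : Schw d, inner ℂ (toL2 d ((l : ℂ) • f - W f)) g = 0) : g = 0 := by
  obtain ⟨C, hC⟩ := secondOrder_le_numBounded hW
  -- Even degrees only, since `W` raises the degree by at most two and so maps level `n` of this
  -- coarser filtration into level `n + 1`.
  let p : ℕ → L2 d := fun n => (hermiteL2 d (2 * n)).starProjection g
  have hpyth : ∀ {m n : ℕ}, m ≤ n → ‖p n - p m‖ ^ 2 = ‖p n‖ ^ 2 - ‖p m‖ ^ 2 := fun h =>
    norm_sub_starProjection_sq (by omega) g
  have hmono : Monotone fun n => ‖p n‖ ^ 2 := fun m n h => by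
    have := hpyth h
    have := sq_nonneg ‖p n - p m‖
    dsimp only
    linarith
  have hbdd : ∀ n, ‖p n‖ ^ 2 ≤ ‖g‖ ^ 2 := fun n => by
    gcongr
    exact Submodule.norm_starProjection_apply_le _ g
  have key : ∀ n : ℕ, l * ‖p (n + 1)‖ ^ 2
      ≤ (5 / 2 * |C|) * (n + 1) * (‖p (n + 2)‖ ^ 2 - ‖p n‖ ^ 2) := by
    intro n
    obtain ⟨u, hu, hup⟩ := exists_hermite_eq_starProjection (2 * (n + 1)) g
    obtain ⟨v, hv, hvp⟩ := exists_hermite_eq_starProjection (2 * n) g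
    change toL2 d u = p (n + 1) at hup
    change toL2 d v = p n at hvp
    have hvu : v ∈ hermiteFilt d (2 * (n + 1)) := hermiteFilt_mono (by omega) hv
    have h0 : ∀ f ∈ hermiteFilt d (2 * (n + 1)), inner ℂ (toL2 d f) (p (n + 1) - g) = 0 := by
      intro f hf
      rw [inner_sub_right, inner_starProjection_of_mem hf, sub_self]
    have h1 : l * ‖p (n + 1)‖ ^ 2 ≤ (inner ℂ (toL2 d ((l : ℂ) • u - W u)) (p (n + 1))).re := by
      rw [← hup, map_sub, map_smul, inner_sub_left, inner_smul_left, inner_self_toL2,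
        Complex.conj_ofReal, ← Complex.ofReal_mul, Complex.sub_re, Complex.ofReal_re,
        ← inner_conj_symm (toL2 d (W u)), Complex.conj_re]
      linarith [hdiss u]
    -- Split `l u - W u = (l u - W v) - W (u - v)`. The first term has level `n + 1`, where `p (n +
    -- 1)` may be replaced by `g`; the second has level `n + 2`, where `g` may be replaced by `p (n
    -- + 2)`; and `l u - W u` is orthogonal to `g`.
    have h2 : inner ℂ (toL2 d ((l : ℂ) • u - W u)) (p (n + 1))
        = -inner ℂ (toL2 d (W (u - v))) (p (n + 1) - p (n + 2)) := by
      have e1 : inner ℂ (toL2 d (W (u - v))) (p (n + 2)) = inner ℂ (toL2 d (W (u - v))) g :=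
        inner_starProjection_of_mem
          (secondOrder_mem_hermiteFilt hW (n := 2 * (n + 1)) (sub_mem hu hvu)) g
      have e2 := h0 _ (sub_mem (Submodule.smul_mem _ (l : ℂ) hu)
        (secondOrder_mem_hermiteFilt hW hv))
      have e3 : (l : ℂ) • u - W u = ((l : ℂ) • u - W v) - W (u - v) := by
        rw [map_sub]; abel
      have e4 := hg u
      rw [e3, map_sub, inner_sub_left] at e4 ⊢
      rw [inner_sub_right] at e2 ⊢
      rw [e1]
      linear_combination e2 + e4
    -- On degree `2(n + 1)` the number operator is at most `4(n + 1)`; adding the `1` of the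
    -- relative bound gives `4n + 5 ≤ 5(n + 1)`. This linear growth is what the harmonic series can
    -- still beat.
    have h3 : ‖toL2 d (W (u - v))‖ ≤ 5 * |C| * (n + 1) * ‖p (n + 1) - p n‖ := by
      have e1 := norm_schNum_le (sub_mem hu hvu)
      have e2 : toL2 d (u - v) = p (n + 1) - p n := by rw [map_sub, hup, hvp]
      rw [e2] at e1
      calc _ ≤ C * (‖toL2 d (schNum d (u - v))‖ + ‖toL2 d (u - v)‖) := hC _
        _ ≤ |C| * (2 * (2 * (n + 1) : ℕ) * ‖p (n + 1) - p n‖ + ‖p (n + 1) - p n‖) := by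
          rw [e2]
          gcongr
          exact le_abs_self C
        _ = |C| * (4 * n + 5) * ‖p (n + 1) - p n‖ := by push_cast; ring
        _ ≤ |C| * (5 * (n + 1)) * ‖p (n + 1) - p n‖ := by
          gcongr
          have : (0 : ℝ) ≤ n := n.cast_nonneg
          linarith
        _ = _ := by ring
    have h4 : (inner ℂ (toL2 d ((l : ℂ) • u - W u)) (p (n + 1))).re
        ≤ 5 * |C| * (n + 1) * ‖p (n + 1) - p n‖ * ‖p (n + 2) - p (n + 1)‖ := by
      refine (Complex.re_le_norm _).trans ?_
      rw [h2, norm_neg, norm_sub_rev (p (n + 2))]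
      exact (norm_inner_le_norm _ _).trans (mul_le_mul_of_nonneg_right h3 (norm_nonneg _))
    have h5 := hpyth (n.le_succ)
    have h6 := hpyth ((n + 1).le_succ)
    have h7 : ‖p (n + 1) - p n‖ * ‖p (n + 2) - p (n + 1)‖
        ≤ (‖p (n + 2)‖ ^ 2 - ‖p n‖ ^ 2) / 2 := by
      have := two_mul_le_add_sq ‖p (n + 1) - p n‖ ‖p (n + 2) - p (n + 1)‖
      simp only [Nat.succ_eq_add_one] at h5 h6
      linarith
    have h8 : 5 * |C| * (n + 1) * (‖p (n + 1) - p n‖ * ‖p (n + 2) - p (n + 1)‖)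
        ≤ 5 * |C| * (n + 1) * ((‖p (n + 2)‖ ^ 2 - ‖p n‖ ^ 2) / 2) := by gcongr
    linarith
  have hzero : ∀ n, p n = 0 := by
    intro n
    have h := nonpos_of_carleman hmono hbdd hl key n
    exact norm_eq_zero.1 (pow_eq_zero_iff two_ne_zero |>.1 (le_antisymm h (sq_nonneg _)))
  have hlim : Tendsto p atTop (𝓝 g) :=
    (tendsto_hermite_starProjection g).comp (tendsto_id.const_mul_atTop' two_pos)
  have : p = fun _ => 0 := funext hzero
  rw [this] at hlim
  exact (tendsto_nhds_unique hlim tendsto_const_nhds)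

/-! ### Closedness of maximal realizations -/

theorem l2Realization_isClosed (P : Distr d →L[ℂ] Distr d) : (l2Realization P).IsClosed := by
  rw [LinearPMap.IsClosed, l2Realization_graph]
  exact isClosed_eq (P.continuous.comp ((toDistr d).continuous.comp continuous_fst))
    ((toDistr d).continuous.comp continuous_snd)

theorem mem_l2Realization_graph_of_tendsto {P : Distr d →L[ℂ] Distr d} {W : Schw d →L[ℂ] Schw d}
    (h : Extends P W) {u : ℕ → Schw d} {f g : L2 d}
    (hf : Tendsto (fun n => toL2 d (u n)) atTop (𝓝 f))
    (hg : Tendsto (fun n => toL2 d (W (u n))) atTop (𝓝 g)) : (f, g) ∈ (l2Realization P).graph := by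
  refine (l2Realization_isClosed P).mem_of_tendsto (hf.prodMk_nhds hg)
    (Eventually.of_forall fun n => ?_)
  rw [l2Realization_graph]
  exact h (u n)

theorem cauchySeq_of_norm_le {W V : Schw d →L[ℂ] Schw d} {C : ℝ}
    (h : ∀ f, ‖toL2 d (W f)‖ ≤ C * (‖toL2 d (V f)‖ + ‖toL2 d f‖)) {u : ℕ → Schw d}
    (hu : CauchySeq fun n => toL2 d (u n)) (hV : CauchySeq fun n => toL2 d (V (u n))) :
    CauchySeq fun n => toL2 d (W (u n)) := by
  have h' : ∀ f, ‖toL2 d (W f)‖ ≤ (|C| + 1) * (‖toL2 d (V f)‖ + ‖toL2 d f‖) := fun f =>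
    (h f).trans (mul_le_mul_of_nonneg_right (by linarith [le_abs_self C]) (by positivity))
  rw [Metric.cauchySeq_iff] at *
  intro ε hε
  have hC : 0 < |C| + 1 := by positivity
  obtain ⟨n1, h1⟩ := hu (ε / (2 * (|C| + 1))) (by positivity)
  obtain ⟨n2, h2⟩ := hV (ε / (2 * (|C| + 1))) (by positivity)
  refine ⟨max n1 n2, fun p hp q hq => ?_⟩
  have e1 := h1 p (le_of_max_le_left hp) q (le_of_max_le_left hq)
  have e2 := h2 p (le_of_max_le_right hp) q (le_of_max_le_right hq)
  have e3 := h' (u p - u q)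
  rw [dist_eq_norm] at *
  simp only [map_sub] at e3
  rw [lt_div_iff₀ (by positivity)] at e1 e2
  nlinarith

/-! ### Approximation of the domain by Hermite functions -/

/-- The projections of `f` with `Δ f, |x|² f ∈ L²` onto the Hermite filtration converge to `f`
together with their images under all operators of second order. -/
theorem exists_approx_of_mem_yDomain {f : L2 d} (hf : f ∈ yDomain d) : ∃ u : ℕ → Schw d,
    Tendsto (fun n => toL2 d (u n)) atTop (𝓝 f) ∧
      ∀ W ∈ secondOrder d, ∃ g, Tendsto (fun n => toL2 d (W (u n))) atTop (𝓝 g) := by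
  obtain ⟨v, hv⟩ := (mem_l2Realization_domain_iff _ _).1 hf.1
  obtain ⟨w, hw⟩ := (mem_l2Realization_domain_iff _ _).1 hf.2
  have hwv : (normSqMul d - laplace d) (Lp.toTemperedDistribution f)
      = Lp.toTemperedDistribution (w - v) := by
    rw [sub_apply, hv, hw]
    exact ((toDistr d).map_sub w v).symm
  choose u hu hup using fun n => exists_hermite_eq_starProjection n f
  have hlim : Tendsto (fun n => toL2 d (u n)) atTop (𝓝 f) := by
    simp only [hup]
    exact tendsto_hermite_starProjection f
  -- The oscillator commutes with the projections: it is symmetric and preserves each level, so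
  -- testing against the level suffices.
  have hosc : ∀ n, toL2 d (schOsc d (u n)) = (hermiteL2 d n).starProjection (w - v) := by
    intro n
    refine (Submodule.eq_starProjection_of_mem_of_inner_eq_zero
      (Submodule.mem_map_of_mem (schOsc_mem_hermiteFilt (hu n)) :
        toL2 d (schOsc d (u n)) ∈ hermiteL2 d n) ?_).symm
    rintro _ ⟨φ, hφ, rfl⟩
    have h1 : inner ℂ (toL2 d φ) (toL2 d (schOsc d (u n))) = inner ℂ (toL2 d φ) (w - v) := by
      have h2 : IsFormalAdj (schOsc d) (schOsc d) := by
        intro a b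
        have h3 := isFormalAdj_schNum (d := d) a b
        simp only [schOsc_apply, map_add, map_smul, inner_add_left, inner_add_right,
          inner_smul_left, inner_smul_right, h3, Complex.conj_natCast]
      rw [← inner_schOsc_left hwv, ← h2, hup,
        inner_starProjection_of_mem (schOsc_mem_hermiteFilt hφ)]
    rw [← inner_conj_symm, map_eq_zero]
    change inner ℂ (toL2 d φ) (w - v - toL2 d (schOsc d (u n))) = 0
    rw [inner_sub_right, h1, sub_self]
  have hnum : Tendsto (fun n => toL2 d (schNum d (u n))) atTop (𝓝 (w - v - (d : ℂ) • f)) := by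
    have h1 : ∀ n, toL2 d (schNum d (u n))
        = (hermiteL2 d n).starProjection (w - v) - (d : ℂ) • toL2 d (u n) := by
      intro n
      rw [← hosc, schOsc_apply, map_add, map_smul]
      abel
    simp only [h1]
    exact (tendsto_hermite_starProjection _).sub (hlim.const_smul _)
  refine ⟨u, hlim, fun W hW => ?_⟩
  obtain ⟨C, hC⟩ := secondOrder_le_numBounded hW
  exact cauchySeq_tendsto_of_complete (cauchySeq_of_norm_le hC hlim.cauchySeq hnum.cauchySeq)

theorem toL2_mem_yDomain (u : Schw d) : toL2 d u ∈ yDomain d :=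
  ⟨(mem_l2Realization_domain_iff _ _).2 ⟨_, extends_laplace u⟩,
    (mem_l2Realization_domain_iff _ _).2 ⟨_, extends_normSqMul u⟩⟩

/-! ### The operator `Y` and its closure -/

section OpY

variable {m : ℕ} (μ : ℝ) (α β : Fin m → Fin d → ℂ) (γ : Fin m → ℂ)

/-- The Hermite approximants of `f` have convergent images under `Y`, and the maximal realization is
closed, so the limit is `Y f` in `L²`. -/
theorem opY_domain : (opY μ α β γ).domain = yDomain d := by
  rw [opY, LinearPMap.domRestrict_domain, inf_eq_left]
  intro f hf
  obtain ⟨u, hu, hW⟩ := exists_approx_of_mem_yDomain hf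
  obtain ⟨g, hg⟩ := hW _ (schY_mem_secondOrder μ α β γ)
  exact LinearPMap.mem_domain_of_mem_graph
    (mem_l2Realization_graph_of_tendsto (extends_yExpr μ α β γ) hu hg)

theorem opY_le : opY μ α β γ ≤ l2Realization (yExpr μ α β γ) := LinearPMap.domRestrict_le

theorem opY_isClosable : (opY μ α β γ).IsClosable :=
  (l2Realization_isClosed _).isClosable.leIsClosable (opY_le μ α β γ)

theorem mem_opY_graph {f g : L2 d} (hf : f ∈ yDomain d)
    (h : (f, g) ∈ (l2Realization (yExpr μ α β γ)).graph) : (f, g) ∈ (opY μ α β γ).graph := by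
  obtain ⟨x, hx, hxg⟩ := (LinearPMap.mem_graph_iff _).1 h
  dsimp only at hx hxg
  subst hx
  have hx : (x : L2 d) ∈ (opY μ α β γ).domain := ⟨hf, x.2⟩
  exact (LinearPMap.mem_graph_iff _).2 ⟨⟨x, hx⟩, rfl,
    ((opY_le μ α β γ).2 (x := ⟨x, hx⟩) (y := x) rfl).trans hxg⟩

/-- Membership in the graph of the closure of `Y`, in terms of Schwartz functions. -/
theorem mem_closure_graph_iff {f g : L2 d} : (f, g) ∈ (opY μ α β γ).closure.graph ↔
    ∃ u : ℕ → Schw d, Tendsto (fun n => toL2 d (u n)) atTop (𝓝 f) ∧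
      Tendsto (fun n => toL2 d (schY μ α β γ (u n))) atTop (𝓝 g) := by
  rw [← (opY_isClosable μ α β γ).graph_closure_eq_closure_graph]
  constructor
  · intro h
    let Γ : Set (L2 d × L2 d) := Set.range fun u : Schw d => (toL2 d u, toL2 d (schY μ α β γ u))
    have h1 : ((opY μ α β γ).graph : Set (L2 d × L2 d)) ⊆ closure Γ := by
      rintro ⟨a, b⟩ hab
      have ha : a ∈ yDomain d := by
        rw [← opY_domain μ α β γ]
        exact LinearPMap.mem_domain_of_mem_graph hab
      obtain ⟨u, hu, hW⟩ := exists_approx_of_mem_yDomain ha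
      obtain ⟨c, hc⟩ := hW _ (schY_mem_secondOrder μ α β γ)
      have h2 := mem_l2Realization_graph_of_tendsto (extends_yExpr μ α β γ) hu hc
      have h3 := LinearPMap.le_graph_of_le (opY_le μ α β γ) hab
      -- Both are the value at `a` of the single-valued maximal realization.
      have h4 : b = c := LinearPMap.mem_graph_snd_inj _ h3 h2 rfl
      rw [h4]
      exact mem_closure_of_tendsto (hu.prodMk_nhds hc) (Eventually.of_forall fun n => ⟨u n, rfl⟩)
    have h2 : (f, g) ∈ closure Γ := closure_minimal h1 isClosed_closure h
    obtain ⟨x, hx, hlim⟩ := mem_closure_iff_seq_limit.1 h2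
    choose u hu using hx
    have h3 : x = fun n => (toL2 d (u n), toL2 d (schY μ α β γ (u n))) :=
      funext fun n => (hu n).symm
    rw [h3] at hlim
    exact ⟨u, hlim.fst_nhds, hlim.snd_nhds⟩
  · rintro ⟨u, hu, hg⟩
    refine mem_closure_of_tendsto (hu.prodMk_nhds hg) (Eventually.of_forall fun n => ?_)
    refine mem_opY_graph μ α β γ (toL2_mem_yDomain _) ?_
    rw [l2Realization_graph]
    exact extends_yExpr μ α β γ (u n)

theorem two_mul_re_inner_schY (f : Schw d) : 2 * (inner ℂ (toL2 d f) (toL2 d (schY μ α β γ f))).re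
    = -∑ j, ‖toL2 d (schL (α j) (β j) (γ j) f)‖ ^ 2 := by
  have h := congrArg Complex.re (inner_schY_add μ α β γ f f)
  simp only [Complex.add_re, Complex.re_sum, inner_self_toL2, Complex.ofReal_re,
    Complex.zero_re] at h
  rw [← inner_conj_symm, Complex.conj_re] at h
  linarith

theorem re_inner_schY_le (f : Schw d) :
    (inner ℂ (toL2 d f) (toL2 d (schY μ α β γ f))).re ≤ 0 := by
  have h1 := two_mul_re_inner_schY μ α β γ f
  have h2 : 0 ≤ ∑ j, ‖toL2 d (schL (α j) (β j) (γ j) f)‖ ^ 2 :=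
    Finset.sum_nonneg fun _ _ => sq_nonneg _
  linarith

/-- The dissipation identity gives `‖Lⱼ f‖² ≤ 2 ‖f‖ ‖Y f‖ ≤ (‖Y f‖ + ‖f‖)²`. -/
theorem norm_schL_le (j : Fin m) (f : Schw d) : ‖toL2 d (schL (α j) (β j) (γ j) f)‖
    ≤ 1 * (‖toL2 d (schY μ α β γ f)‖ + ‖toL2 d f‖) := by
  rw [one_mul]
  refine le_of_sq_le_sq ?_ (by positivity)
  have h1 := two_mul_re_inner_schY μ α β γ f
  have h2 : ‖toL2 d (schL (α j) (β j) (γ j) f)‖ ^ 2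
      ≤ ∑ j, ‖toL2 d (schL (α j) (β j) (γ j) f)‖ ^ 2 :=
    Finset.single_le_sum (f := fun j => ‖toL2 d (schL (α j) (β j) (γ j) f)‖ ^ 2)
      (fun _ _ => sq_nonneg _) (Finset.mem_univ j)
  have h3 := (Complex.abs_re_le_norm _).trans
    (norm_inner_le_norm (𝕜 := ℂ) (toL2 d f) (toL2 d (schY μ α β γ f)))
  have h4 := neg_le_of_abs_le h3
  have h5 := sq_nonneg ‖toL2 d f‖
  have h6 := sq_nonneg ‖toL2 d (schY μ α β γ f)‖
  linarith [add_sq ‖toL2 d (schY μ α β γ f)‖ ‖toL2 d f‖]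

theorem opY_closure_isDissipative : IsDissipative (opY μ α β γ).closure := by
  intro f
  obtain ⟨u, hu, hg⟩ := (mem_closure_graph_iff μ α β γ).1 ((opY μ α β γ).closure.mem_graph f)
  exact le_of_tendsto ((Complex.continuous_re.tendsto _).comp (hu.inner hg))
    (Eventually.of_forall fun n => re_inner_schY_le μ α β γ (u n))

theorem dense_opY_closure_domain : Dense ((opY μ α β γ).closure.domain : Set (L2 d)) := by
  refine (SchwartzMap.denseRange_toLpCLM (p := 2) ENNReal.ofNat_ne_top).mono ?_
  rintro _ ⟨u, rfl⟩
  exact LinearPMap.mem_domain_of_mem_graph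
    ((mem_closure_graph_iff μ α β γ).2 ⟨fun _ => u, tendsto_const_nhds, tendsto_const_nhds⟩)

/-- The range of `l - Y` on Schwartz functions is dense by the Carleman criterion. Dissipativity
bounds `l ‖f‖` by `‖(l - Y) f‖`, so preimages of a convergent sequence are Cauchy and the closure of
`Y` attains every `g`. -/
theorem exists_smul_sub_opY_closure {l : ℝ} (hl : 0 < l) (g : L2 d) :
    ∃ f : (opY μ α β γ).closure.domain, (l : ℂ) • (f : L2 d) - (opY μ α β γ).closure f = g := by
  let S : Submodule ℂ (L2 d) := LinearMap.range ((toL2 d).toLinearMap ∘ₗ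
    ((l : ℂ) • LinearMap.id - (schY μ α β γ).toLinearMap))
  have hS : S.topologicalClosure = ⊤ := by
    rw [Submodule.topologicalClosure_eq_top_iff, Submodule.eq_bot_iff]
    intro w hw
    exact eq_zero_of_forall_inner_secondOrder (schY_mem_secondOrder μ α β γ)
      (re_inner_schY_le μ α β γ) hl fun f => (Submodule.mem_orthogonal _ _).1 hw _ ⟨f, rfl⟩
  have hg : g ∈ closure (S : Set (L2 d)) := by
    rw [← Submodule.topologicalClosure_coe, hS]
    trivial
  obtain ⟨x, hx, hlim⟩ := mem_closure_iff_seq_limit.1 hg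
  choose u hu using hx
  have hxu : ∀ n, x n = (l : ℂ) • toL2 d (u n) - toL2 d (schY μ α β γ (u n)) := by
    intro n
    rw [← hu n, ← map_smul, ← map_sub]
    rfl
  have hc : CauchySeq fun n => toL2 d (u n) := by
    have h1 := hlim.cauchySeq
    rw [Metric.cauchySeq_iff] at h1 ⊢
    intro ε hε
    obtain ⟨n0, hn0⟩ := h1 (l * ε) (by positivity)
    refine ⟨n0, fun p hp q hq => ?_⟩
    have h2 := hn0 p hp q hq
    have h3 := norm_le_norm_smul_sub (re_inner_schY_le μ α β γ (u p - u q)) l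
    rw [dist_eq_norm, hxu, hxu, sub_sub_sub_comm, ← smul_sub, ← map_sub, ← map_sub,
      ← map_sub] at h2
    rw [dist_eq_norm, ← map_sub]
    exact lt_of_mul_lt_mul_left (h3.trans_lt h2) hl.le
  obtain ⟨f, hf⟩ := cauchySeq_tendsto_of_complete hc
  have hY : Tendsto (fun n => toL2 d (schY μ α β γ (u n))) atTop (𝓝 ((l : ℂ) • f - g)) := by
    refine ((hf.const_smul (l : ℂ)).sub hlim).congr fun n => ?_
    rw [hxu]
    abel
  obtain ⟨y, hy, hyg⟩ := (LinearPMap.mem_graph_iff _).1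
    ((mem_closure_graph_iff μ α β γ).2 ⟨u, hf, hY⟩)
  refine ⟨y, ?_⟩
  dsimp only at hy hyg
  rw [hyg, hy, sub_sub_cancel]

/-- On the domain of the closure of `Y` the operators `Lⱼ` are defined, as limits along Schwartz
functions. -/
theorem tendsto_schL {f g : L2 d} {u : ℕ → Schw d}
    (hu : Tendsto (fun n => toL2 d (u n)) atTop (𝓝 f))
    (hg : Tendsto (fun n => toL2 d (schY μ α β γ (u n))) atTop (𝓝 g)) (j : Fin m) :
    ∃ h : L2 d, (f, h) ∈ (opL (α j) (β j) (γ j)).graph ∧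
      Tendsto (fun n => toL2 d (schL (α j) (β j) (γ j) (u n))) atTop (𝓝 h) := by
  obtain ⟨h, hh⟩ := cauchySeq_tendsto_of_complete
    (cauchySeq_of_norm_le (norm_schL_le μ α β γ j) hu.cauchySeq hg.cauchySeq)
  exact ⟨h, mem_l2Realization_graph_of_tendsto (extends_lindblad _ _ _) hu hh, hh⟩

end OpY

/-! ### Commutators of operators of first order -/

theorem commutator_mem_span_of_mem_ladderGen {W V : Schw d →L[ℂ] Schw d} (hW : W ∈ ladderGen d)
    (hV : V ∈ ladderGen d) :
    W ∘L V - V ∘L W ∈ Submodule.span ℂ {ContinuousLinearMap.id ℂ (Schw d)} := by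
  have hAA : ∀ k l : Fin d, schA k ∘L schA l - schA l ∘L schA k = 0 := by
    intro k l
    ext1 f
    rw [sub_apply, ContinuousLinearMap.comp_apply, ContinuousLinearMap.comp_apply, schA_comm,
      sub_self]
    rfl
  have hCC : ∀ k l : Fin d, schC k ∘L schC l - schC l ∘L schC k = 0 := by
    intro k l
    ext1 f
    have : schC k (schC l f) = schC l (schC k f) := by
      simp only [schC_apply, map_sub, schX_comm k l, schD_comm k l, schD_schX]
      simp only [eq_comm (a := k) (b := l)]
      abel
    rw [sub_apply, ContinuousLinearMap.comp_apply, ContinuousLinearMap.comp_apply, this, sub_self]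
    rfl
  have hAC : ∀ k l : Fin d, schA k ∘L schC l - schC l ∘L schA k
      ∈ Submodule.span ℂ {ContinuousLinearMap.id ℂ (Schw d)} := by
    intro k l
    have : schA k ∘L schC l - schC l ∘L schA k
        = (if k = l then (2 : ℂ) else 0) • ContinuousLinearMap.id ℂ (Schw d) := by
      ext1 f
      rw [sub_apply, ContinuousLinearMap.comp_apply, ContinuousLinearMap.comp_apply, schA_schC,
        add_sub_cancel_left, smul_apply, ContinuousLinearMap.id_apply, ite_smul, zero_smul]
    rw [this]
    exact Submodule.smul_mem _ _ (Submodule.mem_span_singleton_self _)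
  rcases hW with (⟨k, rfl⟩ | ⟨k, rfl⟩) | rfl <;> rcases hV with (⟨l, rfl⟩ | ⟨l, rfl⟩) | rfl
  · rw [hAA]; exact zero_mem _
  · exact hAC k l
  · rw [ContinuousLinearMap.comp_id, ContinuousLinearMap.id_comp, sub_self]; exact zero_mem _
  · rw [← neg_sub]; exact neg_mem (hAC l k)
  · rw [hCC]; exact zero_mem _
  all_goals
    simp only [ContinuousLinearMap.comp_id, ContinuousLinearMap.id_comp, sub_self, zero_mem]

theorem commutator_mem_span {W V : Schw d →L[ℂ] Schw d} (hW : W ∈ firstOrder d)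
    (hV : V ∈ firstOrder d) :
    W ∘L V - V ∘L W ∈ Submodule.span ℂ {ContinuousLinearMap.id ℂ (Schw d)} := by
  induction hW using Submodule.span_induction with
  | zero => rw [ContinuousLinearMap.zero_comp, ContinuousLinearMap.comp_zero, sub_self]
            exact zero_mem _
  | add _ _ _ _ h h' =>
    rw [ContinuousLinearMap.add_comp, ContinuousLinearMap.comp_add, add_sub_add_comm]
    exact add_mem h h'
  | smul c _ _ h =>
    rw [ContinuousLinearMap.smul_comp, ContinuousLinearMap.comp_smul, ← smul_sub]
    exact Submodule.smul_mem _ _ h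
  | mem W hW =>
    induction hV using Submodule.span_induction with
    | zero => rw [ContinuousLinearMap.zero_comp, ContinuousLinearMap.comp_zero, sub_self]
              exact zero_mem _
    | add _ _ _ _ h h' =>
      rw [ContinuousLinearMap.add_comp, ContinuousLinearMap.comp_add, add_sub_add_comm]
      exact add_mem h h'
    | smul c _ _ h =>
      rw [ContinuousLinearMap.smul_comp, ContinuousLinearMap.comp_smul, ← smul_sub]
      exact Submodule.smul_mem _ _ h
    | mem V hV => exact commutator_mem_span_of_mem_ladderGen hW hV

/-- By the canonical commutation relations `L L* - L* L` is a scalar `c`, so `‖L* f‖² = ‖L f‖² + c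
‖f‖²`. -/
theorem exists_norm_schLAdj_le (α β : Fin d → ℂ) (γ : ℂ) : ∃ C : ℝ, ∀ f,
    ‖toL2 d (schLAdj α β γ f)‖ ≤ C * (‖toL2 d (schL α β γ f)‖ + ‖toL2 d f‖) := by
  obtain ⟨c, hc⟩ := Submodule.mem_span_singleton.1
    (commutator_mem_span (schL_mem_firstOrder α β γ) (schLAdj_mem_firstOrder α β γ))
  refine ⟨1 + ‖c‖, fun f => le_of_sq_le_sq ?_ (by positivity)⟩
  have h1 : schL α β γ (schLAdj α β γ f) = schLAdj α β γ (schL α β γ f) + c • f := by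
    have := DFunLike.congr_fun hc f
    rw [smul_apply, sub_apply, ContinuousLinearMap.id_apply] at this
    rw [this]
    simp only [ContinuousLinearMap.comp_apply]
    abel
  have h2 : ((‖toL2 d (schLAdj α β γ f)‖ ^ 2 : ℝ) : ℂ)
      = ((‖toL2 d (schL α β γ f)‖ ^ 2 : ℝ) : ℂ) + c * ((‖toL2 d f‖ ^ 2 : ℝ) : ℂ) := by
    rw [← inner_self_toL2, ← inner_self_toL2, ← inner_self_toL2,
      (isFormalAdj_schL α β γ).symm f _, h1, map_add, map_smul, inner_add_right, inner_smul_right,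
      isFormalAdj_schL α β γ f _]
  have h3 : ‖toL2 d (schLAdj α β γ f)‖ ^ 2
      ≤ ‖toL2 d (schL α β γ f)‖ ^ 2 + ‖c‖ * ‖toL2 d f‖ ^ 2 := by
    have h4 := congrArg norm h2
    rw [Complex.norm_real, Real.norm_of_nonneg (sq_nonneg _)] at h4
    rw [h4]
    refine (norm_add_le _ _).trans_eq ?_
    rw [norm_mul, Complex.norm_real, Complex.norm_real, Real.norm_of_nonneg (sq_nonneg _),
      Real.norm_of_nonneg (sq_nonneg _)]
  refine h3.trans ?_
  have ha := norm_nonneg (toL2 d (schL α β γ f))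
  have hb := norm_nonneg (toL2 d f)
  have hcn := norm_nonneg c
  generalize ‖toL2 d (schL α β γ f)‖ = a at *
  generalize ‖toL2 d f‖ = b at *
  generalize ‖c‖ = r at *
  have e : ((1 + r) * (a + b)) ^ 2 = a ^ 2 + r * b ^ 2
      + (2 * a * b + b ^ 2 + r * (2 * (a + b) ^ 2 - b ^ 2) + r ^ 2 * (a + b) ^ 2) := by ring
  have e2 : 0 ≤ r * (2 * (a + b) ^ 2 - b ^ 2) := mul_nonneg hcn (by nlinarith [mul_nonneg ha hb])
  rw [e]
  have e3 : 0 ≤ 2 * a * b + b ^ 2 + r ^ 2 * (a + b) ^ 2 := by positivity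
  linarith

end QuasiFree

end

/-! ### The main theorem -/

theorem mainTheorem9 (d m : ℕ) (μ : ℝ) (α β : Fin m → Fin d → ℂ) (γ : Fin m → ℂ) :
    -- `Y` maps `{f ∈ L² : Δ f, |x|² f ∈ L²}` into `L²`, and it is closable
    (QuasiFree.opY μ α β γ).domain = QuasiFree.yDomain d ∧
    (QuasiFree.opY μ α β γ).IsClosable ∧
    -- (a) the closure generates a `C₀`-semigroup of contractions
    (∃ T : C0ContractionSemigroup (QuasiFree.L2 d),
      T.IsGenerator (QuasiFree.opY μ α β γ).closure) ∧
    -- (b) `Lⱼ` and `Lⱼ*` map the domain of the closure into `L²`, and the identity holds there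
    (∀ j, (QuasiFree.opY μ α β γ).closure.domain ≤
      (QuasiFree.opLAdj (α j) (β j) (γ j)).domain) ∧
    ∃ hL : ∀ j, (QuasiFree.opY μ α β γ).closure.domain ≤
        (QuasiFree.opL (α j) (β j) (γ j)).domain,
      ∀ f g : (QuasiFree.opY μ α β γ).closure.domain,
        inner ℂ ((QuasiFree.opY μ α β γ).closure f) (g : QuasiFree.L2 d)
          + inner ℂ (f : QuasiFree.L2 d) ((QuasiFree.opY μ α β γ).closure g)
          + ∑ j : Fin m,
              inner ℂ (QuasiFree.opL (α j) (β j) (γ j) ⟨f, hL j f.2⟩)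
                (QuasiFree.opL (α j) (β j) (γ j) ⟨g, hL j g.2⟩) = 0 := by
  have happrox := fun f : (QuasiFree.opY μ α β γ).closure.domain =>
    (QuasiFree.mem_closure_graph_iff μ α β γ).1 ((QuasiFree.opY μ α β γ).closure.mem_graph f)
  refine ⟨QuasiFree.opY_domain μ α β γ, QuasiFree.opY_isClosable μ α β γ,
    (QuasiFree.opY_closure_isDissipative μ α β γ).exists_isGenerator
      (QuasiFree.dense_opY_closure_domain μ α β γ)
      fun l hl g => QuasiFree.exists_smul_sub_opY_closure μ α β γ hl g, ?_, ?_, ?_⟩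
  · intro j f hf
    obtain ⟨u, hu, hY⟩ := happrox ⟨f, hf⟩
    obtain ⟨h, -, hh⟩ := QuasiFree.tendsto_schL μ α β γ hu hY j
    obtain ⟨C, hC⟩ := QuasiFree.exists_norm_schLAdj_le (α j) (β j) (γ j)
    obtain ⟨h', hh'⟩ := cauchySeq_tendsto_of_complete
      (QuasiFree.cauchySeq_of_norm_le hC hu.cauchySeq hh.cauchySeq)
    exact LinearPMap.mem_domain_of_mem_graph
      (QuasiFree.mem_l2Realization_graph_of_tendsto (QuasiFree.extends_lindbladAdj _ _ _) hu hh')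
  · intro j f hf
    obtain ⟨u, hu, hY⟩ := happrox ⟨f, hf⟩
    obtain ⟨h, hh, -⟩ := QuasiFree.tendsto_schL μ α β γ hu hY j
    exact LinearPMap.mem_domain_of_mem_graph hh
  · intro f g
    obtain ⟨u, hu, huY⟩ := happrox f
    obtain ⟨v, hv, hvY⟩ := happrox g
    have hlim : ∀ (f : (QuasiFree.opY μ α β γ).closure.domain) (u : ℕ → QuasiFree.Schw d)
        (j : Fin m)
        (hf : (f : QuasiFree.L2 d) ∈ (QuasiFree.opL (α j) (β j) (γ j)).domain),
        Tendsto (fun n => QuasiFree.toL2 d (u n)) atTop (𝓝 f) →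
        Tendsto (fun n => QuasiFree.toL2 d (QuasiFree.schY μ α β γ (u n))) atTop
          (𝓝 ((QuasiFree.opY μ α β γ).closure f)) →
        Tendsto (fun n => QuasiFree.toL2 d (QuasiFree.schL (α j) (β j) (γ j) (u n))) atTop
          (𝓝 (QuasiFree.opL (α j) (β j) (γ j) ⟨f, hf⟩)) := by
      intro f u j hf hu hY
      obtain ⟨h, hh, hlim⟩ := QuasiFree.tendsto_schL μ α β γ hu hY j
      rwa [(LinearPMap.image_iff hf).2 hh] at hlim
    -- The left side is a limit of the same expression along Schwartz functions, where it is
    -- identically zero.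
    refine tendsto_nhds_unique (((huY.inner hv).add (hu.inner hvY)).add
      (tendsto_finsetSum _ fun j _ => (hlim f u j _ hu huY).inner (hlim g v j _ hv hvY))) ?_
    simp only [QuasiFree.inner_schY_add]
    exact tendsto_const_nhds
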